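/- Let $\mathcal H_A,\mathcal H_B,\mathcal H_C$ be copies of $L^2(\mathbb R)$, and let $\hat x$ (multiplication by $x$, on its maximal domain) and $\hat p=-i\,d/dx$ (on $H^1(\mathbb R)$, with $\hbar=1$) be the position and momentum operators on $L^2(\mathbb R)$; a subscript $B$ or $C$ names the factor on which they act. For $P\in\mathbb R$ let $$\hat S^P=\hat{\mathcal P}_{AC}\,e^{i\hat x_C(\hat p_B-P)}:\ \mathcal H_B\otimes\mathcal H_C\to\mathcal H_A\otimes\mathcal H_B$$ be the quantum reference frame transformation from $A$ to $C$ in the sector of total momentum $P$. Here $(e^{i\hat x_C(\hat p_B-P)}\psi)(y,z)=e^{-izP}\psi(y+z,z)$, and $\hat{\mathcal P}_{AC}=\int dx\,|{-x}\rangle_A\langle x|_C$ is the parity swap, $(\hat{\mathcal P}_{AC}\psi)(x_A,x_B)=\psi(x_B,-x_A)$. A bounded operator $\hat O$ on $\mathcal H_B\otimes\mathcal H_C$ is called invariant in the sector $P$ if $\hat S^P\hat O(\hat S^P)^\dagger=\hat{\mathcal P}_{AC}\hat O\hat{\mathcal P}_{AC}^\dagger$. For a bounded operator $\hat O$ and an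 unbounded operator $\hat T$ on $L^2(\mathbb R)$, $[\hat T,\hat O]=0$ (respectively $\{\hat T,\hat O\}=0$) means that $\hat O$ maps the domain of $\hat T$ into itself and that $\hat T\hat Of-\hat O\hat Tf=0$ (respectively $\hat T\hat Of+\hat O\hat Tf=0$) for all $f$ in this domain. Let $\hat O=\hat O_B\otimes\hat O_C$, with $\hat O_B,\hat O_C$ bounded operators on $L^2(\mathbb R)$, be a non-zero Hermitian operator that is invariant in the sector $P=0$. Then: 1. For every $P\neq0$, $\hat O$ fails to be invariant in the sector $P$ if and only if $\{\hat p_B,\hat O_B\}=0$ and $\{\hat x_C,\hat O_C\}=0$. 2. Exactly one of the following two cases occurs: (commuting case) $[\hat p_B,\hat O_B]=0$ and $[\hat x_C,\hat O_C]=0$; (anticommuting case) $\{\hat p_B,\hat O_B\}=0$ and $\{\hat x_C,\hat O_C\}=0$. 3. In the commuting case $\hat O$ is invariant in the sector $P$ for every $P\in\mathbb R$. -/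

import Mathlib

open MeasureTheory
open scoped ENNReal SchwartzMap

noncomputable section

namespace QRF

/-- The state space `L²(ℝ)` of one particle on the line. -/
abbrev H1 : Type := Lp ℂ 2 (volume : Measure ℝ)

/-- The state space `L²(ℝ) ⊗ L²(ℝ) = L²(ℝ²)` of two particles on the line. Relative to `A` the
arguments of a wave function are `(x_B, x_C)`; relative to `C` they are `(x_A, x_B)`. -/
abbrev H2 : Type := Lp ℂ 2 (volume : Measure (ℝ × ℝ))

/-! ### Product vectors and product operators -/

theorem memLp_tensor (f g : H1) :
    MemLp (fun q : ℝ × ℝ => f q.1 * g q.2) 2 (volume : Measure (ℝ × ℝ)) := by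
  have hf : AEStronglyMeasurable (fun q : ℝ × ℝ => f q.1) (volume : Measure (ℝ × ℝ)) :=
    (Lp.aestronglyMeasurable f).comp_fst
  have hg : AEStronglyMeasurable (fun q : ℝ × ℝ => g q.2) (volume : Measure (ℝ × ℝ)) :=
    (Lp.aestronglyMeasurable g).comp_snd
  refine (memLp_two_iff_integrable_sq_norm (hf.mul hg)).2 ?_
  have h := Integrable.mul_prod
    ((memLp_two_iff_integrable_sq_norm (Lp.aestronglyMeasurable f)).1 (Lp.memLp f))
    ((memLp_two_iff_integrable_sq_norm (Lp.aestronglyMeasurable g)).1 (Lp.memLp g))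
  simp only [Pi.mul_apply, norm_mul, mul_pow]
  exact h

/-- The product vector `f ⊗ g`, i.e. `(y, z) ↦ f y * g z`. -/
def tensor (f g : H1) : H2 := (memLp_tensor f g).toLp _

/-- `O = O_B ⊗ O_C`. Product vectors span a dense subspace, so this determines the bounded
operator `O` from `O_B` and `O_C`. -/
def IsTensorProduct (O : H2 →L[ℂ] H2) (OB OC : H1 →L[ℂ] H1) : Prop :=
  ∀ f g : H1, O (tensor f g) = tensor (OB f) (OC g)

/-! ### Position and momentum -/

/-- The position operator `(x̂ f)(x) = x f(x)` on its maximal domain. -/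
def position : H1 →ₗ.[ℂ] H1 where
  domain :=
    { carrier := {f | MemLp (fun x : ℝ => (x : ℂ) * f x) 2 volume}
      add_mem' := fun {f g} hf hg => by
        refine (MemLp.add hf hg).ae_eq ?_
        filter_upwards [Lp.coeFn_add f g] with x hx
        rw [hx]
        exact (mul_add _ _ _).symm
      zero_mem' := by
        refine (MemLp.zero : MemLp (0 : ℝ → ℂ) 2 volume).ae_eq ?_
        filter_upwards [Lp.coeFn_zero ℂ 2 (volume : Measure ℝ)] with x hx
        rw [hx, Pi.zero_apply, mul_zero]
      smul_mem' := fun c f hf => by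
        refine (MemLp.const_smul hf c).ae_eq ?_
        filter_upwards [Lp.coeFn_smul c f] with x hx
        simp [hx, mul_left_comm] }
  toFun :=
    { toFun := fun f => MemLp.toLp (fun x : ℝ => (x : ℂ) * (f : H1) x) f.2
      map_add' := fun f g => by
        rw [← MemLp.toLp_add]
        refine MemLp.toLp_congr _ _ ?_
        filter_upwards [Lp.coeFn_add (f : H1) (g : H1)] with x hx
        rw [Submodule.coe_add, hx, Pi.add_apply, mul_add]
        rfl
      map_smul' := fun c f => by
        rw [RingHom.id_apply, ← MemLp.toLp_const_smul]
        refine MemLp.toLp_congr _ _ ?_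
        filter_upwards [Lp.coeFn_smul c (f : H1)] with x hx
        simp [hx, mul_left_comm] }

/-- `L²(ℝ)` inside the tempered distributions. -/
def toDist : H1 →ₗ[ℂ] 𝓢'(ℝ, ℂ) := (Lp.toTemperedDistributionCLM ℂ volume 2).toLinearMap

theorem toDist_injective : Function.Injective toDist :=
  LinearMap.ker_eq_bot.1 Lp.ker_toTemperedDistributionCLM_eq_bot

/-- The distributional derivative of a function in `L²(ℝ)`. -/
def distDeriv : H1 →ₗ[ℂ] 𝓢'(ℝ, ℂ) := (TemperedDistribution.derivCLM ℂ).toLinearMap ∘ₗ toDist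

/-- The Sobolev space `H¹(ℝ)`: the `f ∈ L²(ℝ)` whose distributional derivative is in `L²(ℝ)`. -/
def sobolev : Submodule ℂ H1 := (LinearMap.range toDist).comap distDeriv

/-- The derivative `H¹(ℝ) → L²(ℝ)`. -/
def weakDeriv : sobolev →ₗ[ℂ] H1 :=
  (LinearEquiv.ofInjective toDist toDist_injective).symm.toLinearMap ∘ₗ
    (distDeriv ∘ₗ sobolev.subtype).codRestrict (LinearMap.range toDist) fun f => f.2

theorem toDist_weakDeriv (f : sobolev) : toDist (weakDeriv f) = distDeriv (f : H1) :=
  congrArg Subtype.val (LinearEquiv.apply_symm_apply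
    (LinearEquiv.ofInjective toDist toDist_injective) ⟨distDeriv (f : H1), f.2⟩)

/-- The momentum operator `p̂ f = -i f'` (with `ħ = 1`) on the domain `H¹(ℝ)`. -/
def momentum : H1 →ₗ.[ℂ] H1 where
  domain := sobolev
  toFun := (-Complex.I) • weakDeriv

/-- `[T, O] = 0` for an unbounded operator `T` and a bounded operator `O`: `O` preserves the domain
of `T`, and `T O f - O T f = 0` for all `f` in it. -/
def CommutatorZero (T : H1 →ₗ.[ℂ] H1) (O : H1 →L[ℂ] H1) : Prop :=
  ∀ f : T.domain, ∃ h : O f ∈ T.domain, T ⟨O f, h⟩ - O (T f) = 0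

/-- `{T, O} = 0` for an unbounded operator `T` and a bounded operator `O`: `O` preserves the domain
of `T`, and `T O f + O T f = 0` for all `f` in it. -/
def AnticommutatorZero (T : H1 →ₗ.[ℂ] H1) (O : H1 →L[ℂ] H1) : Prop :=
  ∀ f : T.domain, ∃ h : O f ∈ T.domain, T ⟨O f, h⟩ + O (T f) = 0

/-! ### The change of quantum reference frame -/

theorem measurePreserving_shear :
    MeasurePreserving (fun q : ℝ × ℝ => (q.1 + q.2, q.2)) volume volume :=
  measurePreserving_add_prod (volume : Measure ℝ) (volume : Measure ℝ)

theorem measurePreserving_paritySwap :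
    MeasurePreserving (fun q : ℝ × ℝ => (q.2, -q.1)) volume volume :=
  (((MeasurePreserving.id (volume : Measure ℝ)).prod
    (Measure.measurePreserving_neg (volume : Measure ℝ)))).comp Measure.measurePreserving_swap

theorem memLp_phase (P : ℝ) :
    MemLp (fun q : ℝ × ℝ => Complex.exp (-(Complex.I * q.2 * P))) ∞
      (volume : Measure (ℝ × ℝ)) := by
  refine memLp_top_of_bound (by fun_prop) 1 (Filter.Eventually.of_forall fun q => ?_)
  rw [Complex.norm_exp]
  simp

/-- The controlled translation `exp (i x̂_C (p̂_B - P))`. Since `exp (i z p̂)` is the translation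
`f ↦ f (· + z)`, it maps `ψ` to `(y, z) ↦ exp (-i z P) * ψ (y + z, z)`. -/
def expXP (P : ℝ) : H2 →L[ℂ] H2 :=
  (ContinuousLinearMap.mul ℂ ℂ).holderL volume ∞ 2 2 ((memLp_phase P).toLp _) ∘L
    (Lp.compMeasurePreservingₗᵢ ℂ _ measurePreserving_shear).toContinuousLinearMap

theorem expXP_apply (P : ℝ) (ψ : H2) :
    ∀ᵐ q : ℝ × ℝ, expXP P ψ q = Complex.exp (-(Complex.I * q.2 * P)) * ψ (q.1 + q.2, q.2) := by
  let φ : H2 := Lp.compMeasurePreservingₗᵢ ℂ _ measurePreserving_shear ψ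
  have hφ := Lp.coeFn_compMeasurePreserving ψ measurePreserving_shear
  have h := (ContinuousLinearMap.mul ℂ ℂ).coeFn_holder (r := 2) ((memLp_phase P).toLp _) φ
  filter_upwards [h, hφ, (memLp_phase P).coeFn_toLp] with q h₁ h₂ h₃
  exact h₁.trans (by rw [h₃]; exact congrArg _ h₂)

/-- The parity swap `∫ dx |-x⟩_A ⟨x|_C` from the description relative to `A` to the one relative
to `C`; it maps `ψ` to `(x_A, x_B) ↦ ψ (x_B, -x_A)`. -/
def paritySwap : H2 →L[ℂ] H2 :=
  (Lp.compMeasurePreservingₗᵢ ℂ _ measurePreserving_paritySwap).toContinuousLinearMap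

/-- The QRF transformation `S^P = 𝒫_{AC} exp (i x̂_C (p̂_B - P))` from `A` to `C` in the sector of
total momentum `P`. -/
def transformation (P : ℝ) : H2 →L[ℂ] H2 := paritySwap ∘L expXP P

/-- `O` is invariant under the QRF transformation in the sector `P`, i.e. up to a parity swap:
`S^P O (S^P)† = 𝒫_{AC} O 𝒫_{AC}†`. -/
def Invariant (P : ℝ) (O : H2 →L[ℂ] H2) : Prop :=
  transformation P ∘L O ∘L (transformation P).adjoint = paritySwap ∘L O ∘L paritySwap.adjoint

end QRF

end

/-! The parity swap cancels, so invariance in the sector `P` means commuting with `expXP P`, which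
is a phase in `x_C` times `expXP 0` (`invariant_iff_commute`, `invariant_iff_commute_phaseOp`).
Write `A = OB`, `K = OC` and `T_z` for translations. Since `expXP 0` translates the first factor by
the position of the second, its slices in the first factor are multiplication operators on the
second. Hence invariance in the sector `0` says that `K` intertwines multiplication by `z ↦ ⟨f, T_z
A g⟩` with multiplication by `z ↦ ⟨f, A T_z g⟩`, for all `f`, `g` (`mulOp_correlation_comp`).

By Fuglede–Putnam and polynomial approximation, the pairs of Borel sets whose indicators `K`
intertwines form a σ-algebra on `ℝ ⊕ ℝ`, and the bounded functions measurable for it are intertwined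
too. The map sending the left `z` to `T_z A` and the right `z` to `A T_z` is measurable for this
σ-algebra, and each half of it is a Borel embedding. Pulling back the image of the right half shows
that `K = 0` if only a null set of `z` admits some `z'` with `T_z A = A T_{z'}`
(`eq_zero_of_countable`).

The pairs `(z, z')` with `T_z A = A T_{z'}` form a group, symmetric because `A` is a multiple of its
adjoint. Its diagonal and antidiagonal parts are closed subgroups of `ℝ`; were both proper, the set
of such `z` would be countable. So `T_a A = A T_{ε a}` for all `a`, with a sign `ε`, and the
σ-algebra then yields `M_h K = K M_{h(ε ·)}` for all bounded Borel `h` (`exists_sign`). Passing to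
generators gives `p̂ A = ε A p̂` and `x̂ K = ε K x̂`. For `ε = 1`, `K` commutes with every phase;
for `ε = -1` and `P ≠ 0`, commuting with the phase would force `K = 0`. A non-zero `K` cannot both
commute and anticommute with `x̂`. -/

noncomputable section

namespace QRF

/-! ### Multiplication operators -/

open Classical in
/-- Multiplication by an essentially bounded function `h` (zero if `h` is not in `L^∞`). -/
def mulOp (h : ℝ → ℂ) : H1 →L[ℂ] H1 :=
  if hh : MemLp h ∞ (volume : Measure ℝ) then
    (ContinuousLinearMap.mul ℂ ℂ).holderL volume ∞ 2 2 (hh.toLp h) else 0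

theorem mulOp_apply {h : ℝ → ℂ} (hh : MemLp h ∞ (volume : Measure ℝ)) (g : H1) :
    ∀ᵐ x : ℝ, mulOp h g x = h x * g x := by
  have h₁ := (ContinuousLinearMap.mul ℂ ℂ).coeFn_holder (r := 2) (hh.toLp h) g
  filter_upwards [h₁, hh.coeFn_toLp] with x h₁ h₂
  rw [mulOp, dif_pos hh]
  exact h₁.trans (by rw [h₂]; rfl)

theorem memLp_top_of_measurable_of_bound {h : ℝ → ℂ} (hm : Measurable h)
    (hb : ∃ C, ∀ x, ‖h x‖ ≤ C) : MemLp h ∞ (volume : Measure ℝ) :=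
  memLp_top_of_bound hm.aestronglyMeasurable hb.choose
    (Filter.Eventually.of_forall hb.choose_spec)

theorem inner_mulOp {h : ℝ → ℂ} (hh : MemLp h ∞ (volume : Measure ℝ)) (f g : H1) :
    inner ℂ f (mulOp h g) = ∫ x, h x * inner ℂ (f x) (g x) := by
  rw [L2.inner_def]
  refine integral_congr_ae ?_
  filter_upwards [mulOp_apply hh g] with x hx
  rw [hx, ← smul_eq_mul, inner_smul_right]

theorem mulOp_add {h k : ℝ → ℂ} (hh : MemLp h ∞ (volume : Measure ℝ))
    (hk : MemLp k ∞ (volume : Measure ℝ)) : mulOp (h + k) = mulOp h + mulOp k := by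
  ext1 g
  refine Lp.ext ?_
  filter_upwards [mulOp_apply hh g, mulOp_apply hk g, mulOp_apply (hh.add hk) g,
    Lp.coeFn_add (mulOp h g) (mulOp k g)] with x h₁ h₂ h₃ h₄
  rw [h₃, add_apply, h₄, Pi.add_apply, Pi.add_apply, h₁, h₂, add_mul]

theorem memLp_top_mul {h k : ℝ → ℂ} (hh : MemLp h ∞ (volume : Measure ℝ))
    (hk : MemLp k ∞ (volume : Measure ℝ)) : MemLp (h * k) ∞ (volume : Measure ℝ) :=
  hk.mul hh

theorem mulOp_mul {h k : ℝ → ℂ} (hh : MemLp h ∞ (volume : Measure ℝ))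
    (hk : MemLp k ∞ (volume : Measure ℝ)) : mulOp (h * k) = mulOp h ∘L mulOp k := by
  ext1 g
  refine Lp.ext ?_
  filter_upwards [mulOp_apply hk g, mulOp_apply hh (mulOp k g),
    mulOp_apply (memLp_top_mul hh hk) g] with x h₁ h₂ h₃
  rw [h₃, ContinuousLinearMap.comp_apply, h₂, h₁, Pi.mul_apply, mul_assoc]

theorem mulOp_const (c : ℂ) : mulOp (fun _ => c) = c • ContinuousLinearMap.id ℂ H1 := by
  ext1 g
  refine Lp.ext ?_
  filter_upwards [mulOp_apply (memLp_top_const c) g, Lp.coeFn_smul c g] with x h₁ h₂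
  rw [h₁, smul_apply, ContinuousLinearMap.id_apply, h₂, Pi.smul_apply, smul_eq_mul]

theorem mulOp_eq_zero_of_ae {h : ℝ → ℂ} (hh : h =ᵐ[volume] 0) : mulOp h = 0 := by
  have hm : MemLp h ∞ (volume : Measure ℝ) :=
    (MemLp.zero : MemLp (0 : ℝ → ℂ) ∞ volume).ae_eq hh.symm
  ext1 g
  refine Lp.ext ?_
  filter_upwards [mulOp_apply hm g, hh, Lp.coeFn_zero ℂ 2 (volume : Measure ℝ)] with x h₁ h₂ h₃
  rw [h₁, h₂, Pi.zero_apply, zero_mul, zero_apply, h₃, Pi.zero_apply]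

theorem adjoint_mulOp {h : ℝ → ℂ} (hh : MemLp h ∞ (volume : Measure ℝ)) :
    (mulOp h).adjoint = mulOp (star h) := by
  refine ((ContinuousLinearMap.eq_adjoint_iff _ _).2 fun f g => ?_).symm
  rw [inner_mulOp hh, L2.inner_def]
  refine integral_congr_ae ?_
  filter_upwards [mulOp_apply hh.star f] with x hx
  rw [hx, ← smul_eq_mul, inner_smul_left]
  simp

theorem isStarNormal_mulOp {h : ℝ → ℂ} (hh : MemLp h ∞ (volume : Measure ℝ)) :
    IsStarNormal (mulOp h) := by
  refine ⟨?_⟩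
  rw [ContinuousLinearMap.star_eq_adjoint, adjoint_mulOp hh]
  exact (mulOp_mul hh.star hh).symm.trans ((congrArg mulOp (mul_comm _ _)).trans
    (mulOp_mul hh hh.star))

/-! ### Translations -/

theorem measurePreserving_addRight (z : ℝ) :
    MeasurePreserving (fun y : ℝ => y + z) volume volume :=
  measurePreserving_add_right volume z

/-- The translation `(T_z f)(y) = f (y + z)`, i.e. `exp (i z p̂)`. -/
def translation (z : ℝ) : H1 →L[ℂ] H1 :=
  (Lp.compMeasurePreservingₗᵢ ℂ _ (measurePreserving_addRight z)).toContinuousLinearMap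

theorem translation_apply (z : ℝ) (f : H1) : ∀ᵐ y : ℝ, translation z f y = f (y + z) :=
  Lp.coeFn_compMeasurePreserving f (measurePreserving_addRight z)

theorem translation_zero : translation 0 = ContinuousLinearMap.id ℂ H1 := by
  ext1 f
  refine Lp.ext ?_
  filter_upwards [translation_apply 0 f] with y hy
  rw [hy, add_zero, ContinuousLinearMap.id_apply]

theorem translation_add (a b : ℝ) : translation (a + b) = translation a ∘L translation b := by
  ext1 f
  refine Lp.ext ?_
  filter_upwards [translation_apply (a + b) f, translation_apply a (translation b f),
    (measurePreserving_addRight a).quasiMeasurePreserving.ae (translation_apply b f)]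
    with y h₁ h₂ h₃
  rw [h₁, ContinuousLinearMap.comp_apply, h₂, h₃, add_assoc]

theorem translation_add_apply (a b : ℝ) (f : H1) :
    translation (a + b) f = translation a (translation b f) := by
  rw [translation_add, ContinuousLinearMap.comp_apply]

theorem translation_neg_apply_self (z : ℝ) (f : H1) :
    translation (-z) (translation z f) = f := by
  rw [← translation_add_apply, neg_add_cancel, translation_zero, ContinuousLinearMap.id_apply]

theorem norm_translation_apply (z : ℝ) (f : H1) : ‖translation z f‖ = ‖f‖ :=
  (Lp.compMeasurePreservingₗᵢ ℂ _ (measurePreserving_addRight z)).norm_map f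

theorem inner_translation_translation (z : ℝ) (f g : H1) :
    inner ℂ (translation z f) (translation z g) = inner ℂ f g :=
  (Lp.compMeasurePreservingₗᵢ ℂ _ (measurePreserving_addRight z)).inner_map_map f g

theorem inner_translation_right (z : ℝ) (f g : H1) :
    inner ℂ f (translation z g) = inner ℂ (translation (-z) f) g := by
  rw [← inner_translation_translation (-z), translation_neg_apply_self]

theorem adjoint_translation (z : ℝ) : (translation z).adjoint = translation (-z) :=
  ((ContinuousLinearMap.eq_adjoint_iff _ _).2 fun f g =>
    (inner_translation_right z f g).symm).symm

theorem continuous_translation_apply (f : H1) : Continuous fun z => translation z f := by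
  let g : ℝ → C(ℝ, ℝ) := fun z => ⟨fun y => y + z, by fun_prop⟩
  have hg : Continuous g := ContinuousMap.continuous_of_continuous_uncurry _ (by
    change Continuous fun q : ℝ × ℝ => q.2 + q.1
    fun_prop)
  exact (continuous_const (y := f)).compMeasurePreservingLp hg measurePreserving_addRight
    ENNReal.ofNat_ne_top

/-- A square-integrable function on the line with a non-zero period vanishes. -/
theorem eq_zero_of_translation_eq_self {a : ℝ} (ha : a ≠ 0) {f : H1} (hf : translation a f = f) :
    f = 0 := by
  wlog hpos : 0 < a generalizing a
  · refine this (neg_ne_zero.2 ha) ?_ (neg_pos.2 (lt_of_le_of_ne (not_lt.1 hpos) ha))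
    conv_lhs => rw [← hf, translation_neg_apply_self]
  have hz (γ : AddSubgroup.zmultiples a) : translation γ f = f := by
    let S : AddSubgroup ℝ :=
      { carrier := {b | translation b f = f}
        add_mem' := fun {b c} hb hc => by
          change translation (b + c) f = f
          rw [translation_add_apply, hc, hb]
        zero_mem' := by
          change translation 0 f = f
          rw [translation_zero, ContinuousLinearMap.id_apply]
        neg_mem' := fun {b} hb => by
          change translation (-b) f = f
          conv_lhs => rw [← hb, translation_neg_apply_self] }
    exact AddSubgroup.zmultiples_le_of_mem (H := S) hf γ.2
  -- The finite integral of `‖f‖²` is a sum over infinitely many period cells, all contributing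
  -- equally.
  have hsum := (isAddFundamentalDomain_Ioc hpos 0 volume).lintegral_eq_tsum'
    (fun x => ‖f x‖ₑ ^ (2 : ℝ))
  have hterm (γ : AddSubgroup.zmultiples a) :
      ∫⁻ x in Set.Ioc 0 (0 + a), ‖f (-γ +ᵥ x)‖ₑ ^ (2 : ℝ) =
        ∫⁻ x in Set.Ioc 0 (0 + a), ‖f x‖ₑ ^ (2 : ℝ) := by
    refine lintegral_congr_ae (ae_restrict_of_ae ?_)
    have h := translation_apply (-γ : AddSubgroup.zmultiples a) f
    rw [hz] at h
    filter_upwards [h] with x hx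
    rw [hx, AddSubgroup.vadd_def, vadd_eq_add, add_comm]
  simp_rw [hterm] at hsum
  have hinf : Infinite (AddSubgroup.zmultiples a) := by
    refine Infinite.of_injective (fun n : ℤ => ⟨n • a, AddSubgroup.zsmul_mem_zmultiples a n⟩) ?_
    intro m n h
    have h' := congrArg Subtype.val h
    simp only [zsmul_eq_mul, mul_eq_mul_right_iff, Int.cast_inj] at h'
    exact h'.resolve_right ha
  have hfin : ∫⁻ x, ‖f x‖ₑ ^ (2 : ℝ) ≠ ∞ := by
    simpa using (eLpNorm_lt_top_iff_lintegral_rpow_enorm_lt_top two_ne_zero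
      ENNReal.ofNat_ne_top).1 (Lp.memLp f).eLpNorm_lt_top |>.ne
  have hc : ∫⁻ x in Set.Ioc 0 (0 + a), ‖f x‖ₑ ^ (2 : ℝ) = 0 := by
    by_contra hc
    exact hfin (hsum.trans (ENNReal.tsum_const_eq_top_of_ne_zero hc))
  rw [hc, tsum_zero, lintegral_eq_zero_iff' (by fun_prop)] at hsum
  refine Lp.ext ?_
  filter_upwards [hsum, Lp.coeFn_zero ℂ 2 (volume : Measure ℝ)] with x h₁ h₂
  simpa [h₂] using h₁

/-! ### Product vectors -/

theorem tensor_apply (f g : H1) : ∀ᵐ q : ℝ × ℝ, tensor f g q = f q.1 * g q.2 :=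
  (memLp_tensor f g).coeFn_toLp

theorem inner_tensor_tensor (f g f' g' : H1) :
    inner ℂ (tensor f g) (tensor f' g') = inner ℂ f f' * inner ℂ g g' := by
  rw [L2.inner_def, L2.inner_def, L2.inner_def, ← integral_prod_mul]
  refine integral_congr_ae ?_
  filter_upwards [tensor_apply f g, tensor_apply f' g'] with q h₁ h₂
  rw [h₁, h₂]
  simp only [RCLike.inner_apply, map_mul]
  ring

theorem tensor_smul_left (c : ℂ) (f g : H1) : tensor (c • f) g = c • tensor f g := by
  refine Lp.ext ?_
  filter_upwards [tensor_apply (c • f) g, tensor_apply f g, Lp.coeFn_smul c (tensor f g),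
    Measure.quasiMeasurePreserving_fst.ae (Lp.coeFn_smul c f)] with q h₁ h₂ h₃ h₄
  rw [h₁, h₃, h₄, Pi.smul_apply, Pi.smul_apply, h₂, smul_mul_assoc]

theorem tensor_smul_right (c : ℂ) (f g : H1) : tensor f (c • g) = c • tensor f g := by
  refine Lp.ext ?_
  filter_upwards [tensor_apply f (c • g), tensor_apply f g, Lp.coeFn_smul c (tensor f g),
    Measure.quasiMeasurePreserving_snd.ae (Lp.coeFn_smul c g)] with q h₁ h₂ h₃ h₄
  rw [h₁, h₃, h₄, Pi.smul_apply, Pi.smul_apply, h₂, mul_smul_comm]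

theorem tensor_zero_left (g : H1) : tensor 0 g = 0 := by
  simpa using tensor_smul_left 0 0 g

theorem tensor_zero_right (f : H1) : tensor f 0 = 0 := by
  simpa using tensor_smul_right 0 f 0

theorem tensor_right_cancel {f g g' : H1} (hf : f ≠ 0) (h : tensor f g = tensor f g') : g = g' := by
  refine ext_inner_left ℂ fun u => ?_
  have h' := congrArg (fun ψ => inner ℂ (tensor f u) ψ) h
  simp only [inner_tensor_tensor] at h'
  exact mul_left_cancel₀ (inner_self_ne_zero.2 hf) h'

/-- Product vectors are total in `L²(ℝ²)`. -/
theorem eq_zero_of_forall_inner_tensor {ψ : H2} (h : ∀ f g, inner ℂ (tensor f g) ψ = 0) :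
    ψ = 0 := by
  have hloc (s : Set (ℝ × ℝ)) (hs : volume s < ∞) : IntegrableOn ψ s volume := by
    have : Fact (volume s < ∞) := ⟨hs⟩
    exact ((Lp.memLp ψ).restrict s).integrable (by norm_num)
  have hrect (E F : Set ℝ) (hE : MeasurableSet E) (hF : MeasurableSet F) (hE' : volume E ≠ ∞)
      (hF' : volume F ≠ ∞) : ∫ q in E ×ˢ F, ψ q = 0 := by
    have h₀ := h (indicatorConstLp 2 hE hE' 1) (indicatorConstLp 2 hF hF' 1)
    rw [L2.inner_def] at h₀
    rw [← h₀, ← integral_indicator (hE.prod hF)]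
    refine integral_congr_ae ?_
    filter_upwards [tensor_apply (indicatorConstLp 2 hE hE' 1) (indicatorConstLp 2 hF hF' 1),
      Measure.quasiMeasurePreserving_fst.ae
        (indicatorConstLp_coeFn (p := 2) (hs := hE) (hμs := hE') (c := (1 : ℂ))),
      Measure.quasiMeasurePreserving_snd.ae
        (indicatorConstLp_coeFn (p := 2) (hs := hF) (hμs := hF') (c := (1 : ℂ)))] with q h₁ h₂ h₃
    rw [h₁, h₂, h₃]
    by_cases h₄ : q.1 ∈ E <;> by_cases h₅ : q.2 ∈ F <;> simp [Set.indicator, h₄, h₅]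
  let I (n : ℕ) : Set ℝ := Set.Icc (-n) n
  have hI (n : ℕ) : volume (I n) ≠ ∞ := by simp [I]
  have hbox (n : ℕ) : volume (I n ×ˢ I n) < ∞ := by
    rw [Measure.volume_eq_prod, Measure.prod_prod]
    exact ENNReal.mul_lt_top (hI n).lt_top (hI n).lt_top
  have hmeas (n : ℕ) : MeasurableSet (I n ×ˢ I n) := measurableSet_Icc.prod measurableSet_Icc
  -- Rectangles are a generating π-system. Restricting to a box of finite measure makes `ψ`
  -- integrable, so the sets with zero integral are closed under complements and disjoint unions.
  have hset (n : ℕ) (s : Set (ℝ × ℝ)) (hs : MeasurableSet s) :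
      ∫ q in s, ψ q ∂(volume.restrict (I n ×ˢ I n)) = 0 := by
    have hint : Integrable ψ (volume.restrict (I n ×ˢ I n)) := hloc _ (hbox n)
    have huniv : ∫ q, ψ q ∂(volume.restrict (I n ×ˢ I n)) = 0 :=
      hrect _ _ measurableSet_Icc measurableSet_Icc (hI n) (hI n)
    induction s, hs using MeasurableSpace.induction_on_inter generateFrom_prod.symm
      isPiSystem_prod with
    | empty => simp
    | basic t ht =>
      obtain ⟨E, hE : MeasurableSet E, F, hF : MeasurableSet F, rfl⟩ := ht
      rw [Measure.restrict_restrict (hE.prod hF), Set.prod_inter_prod]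
      exact hrect _ _ (hE.inter measurableSet_Icc)
        (hF.inter measurableSet_Icc)
        (measure_ne_top_of_subset Set.inter_subset_right (hI n))
        (measure_ne_top_of_subset Set.inter_subset_right (hI n))
    | compl t ht ih =>
      have := integral_add_compl ht hint
      rwa [ih, zero_add, huniv] at this
    | iUnion f hd hf ih =>
      rw [integral_iUnion hf hd hint.integrableOn]
      simp [ih]
  have hae (n : ℕ) : ∀ᵐ q : ℝ × ℝ, q ∈ I n ×ˢ I n → ψ q = 0 := by
    rw [← ae_restrict_iff' (hmeas n)]
    exact Integrable.ae_eq_of_forall_setIntegral_eq _ _ (hloc _ (hbox n)) (integrable_zero _ _ _)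
      fun s hs _ => by simpa using hset n s hs
  refine Lp.ext ?_
  filter_upwards [ae_all_iff.2 hae, Lp.coeFn_zero ℂ 2 (volume : Measure (ℝ × ℝ))] with q h₁ h₂
  obtain ⟨n, hn⟩ := exists_nat_ge (max |q.1| |q.2|)
  rw [h₂]
  exact h₁ n ⟨abs_le.1 ((le_max_left _ _).trans hn), abs_le.1 ((le_max_right _ _).trans hn)⟩

/-- Totality is available as triviality of the orthogonal complement, hence the passage to adjoints.
-/
theorem clm_eq_of_forall_tensor {A B : H2 →L[ℂ] H2}
    (h : ∀ f g, A (tensor f g) = B (tensor f g)) : A = B := by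
  refine ContinuousLinearMap.adjoint.injective ?_
  ext1 ψ
  refine sub_eq_zero.1 (eq_zero_of_forall_inner_tensor fun f g => ?_)
  rw [inner_sub_right, ContinuousLinearMap.adjoint_inner_right,
    ContinuousLinearMap.adjoint_inner_right, h, sub_self]

/-! ### The controlled translation -/

/-- Multiplication by the phase `exp (-i z P)` on `L²(ℝ²)`. -/
def phaseOp (P : ℝ) : H2 →L[ℂ] H2 :=
  (ContinuousLinearMap.mul ℂ ℂ).holderL volume ∞ 2 2 ((memLp_phase P).toLp _)

theorem phaseOp_apply (P : ℝ) (ψ : H2) :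
    ∀ᵐ q : ℝ × ℝ, phaseOp P ψ q = Complex.exp (-(Complex.I * q.2 * P)) * ψ q := by
  have h := (ContinuousLinearMap.mul ℂ ℂ).coeFn_holder (r := 2) ((memLp_phase P).toLp _) ψ
  filter_upwards [h, (memLp_phase P).coeFn_toLp] with q h₁ h₂
  exact h₁.trans (by rw [h₂]; rfl)

/-- The phase `z ↦ exp (-i z P)`. -/
def phase (P : ℝ) (z : ℝ) : ℂ := Complex.exp (-(Complex.I * z * P))

theorem norm_phase (P z : ℝ) : ‖phase P z‖ = 1 := by
  rw [phase, Complex.norm_exp]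
  simp

theorem measurable_phase (P : ℝ) : Measurable (phase P) := by
  unfold phase
  fun_prop

theorem memLp_top_phase (P : ℝ) : MemLp (phase P) ∞ (volume : Measure ℝ) :=
  memLp_top_of_measurable_of_bound (measurable_phase P) ⟨1, fun z => (norm_phase P z).le⟩

theorem phaseOp_tensor (P : ℝ) (f g : H1) :
    phaseOp P (tensor f g) = tensor f (mulOp (phase P) g) := by
  refine Lp.ext ?_
  filter_upwards [phaseOp_apply P (tensor f g), tensor_apply f g,
    tensor_apply f (mulOp (phase P) g),
    Measure.quasiMeasurePreserving_snd.ae (mulOp_apply (memLp_top_phase P) g)] with q h₁ h₂ h₃ h₄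
  rw [h₁, h₂, h₃, h₄, phase]
  ring

theorem phaseOp_neg_apply (P : ℝ) (ψ : H2) : phaseOp P (phaseOp (-P) ψ) = ψ := by
  refine Lp.ext ?_
  filter_upwards [phaseOp_apply P (phaseOp (-P) ψ), phaseOp_apply (-P) ψ] with q h₁ h₂
  rw [h₁, h₂, ← mul_assoc, ← Complex.exp_add]
  simp

theorem expXP_eq_phaseOp_comp (P : ℝ) : expXP P = phaseOp P ∘L expXP 0 := by
  ext1 ψ
  refine Lp.ext ?_
  filter_upwards [expXP_apply P ψ, expXP_apply 0 ψ, phaseOp_apply P (expXP 0 ψ)] with q h₁ h₂ h₃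
  rw [h₁, ContinuousLinearMap.comp_apply, h₃, h₂]
  simp

theorem norm_expXP_apply (P : ℝ) (ψ : H2) : ‖expXP P ψ‖ = ‖ψ‖ := by
  rw [← Lp.norm_compMeasurePreserving ψ measurePreserving_shear, Lp.norm_def, Lp.norm_def]
  congr 1
  refine eLpNorm_congr_norm_ae ?_
  filter_upwards [expXP_apply P ψ, Lp.coeFn_compMeasurePreserving ψ measurePreserving_shear]
    with q h₁ h₂
  rw [h₁, h₂, norm_mul, Complex.norm_exp]
  simp

theorem expXP_zero_surjective : Function.Surjective (expXP 0) := by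
  intro ψ
  have hmp : MeasurePreserving (fun q : ℝ × ℝ => (q.1 - q.2, q.2)) volume volume :=
    measurePreserving_sub_prod (volume : Measure ℝ) (volume : Measure ℝ)
  refine ⟨Lp.compMeasurePreserving _ hmp ψ, Lp.ext ?_⟩
  filter_upwards [expXP_apply 0 (Lp.compMeasurePreserving _ hmp ψ),
    measurePreserving_shear.quasiMeasurePreserving.ae (Lp.coeFn_compMeasurePreserving ψ hmp)]
    with q h₁ h₂
  rw [h₁, h₂]
  simp

theorem expXP_surjective (P : ℝ) : Function.Surjective (expXP P) := by
  intro ψ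
  obtain ⟨φ, hφ⟩ := expXP_zero_surjective (phaseOp (-P) ψ)
  exact ⟨φ, by rw [expXP_eq_phaseOp_comp, ContinuousLinearMap.comp_apply, hφ, phaseOp_neg_apply]⟩

theorem adjoint_expXP_comp_self (P : ℝ) :
    (expXP P).adjoint ∘L expXP P = ContinuousLinearMap.id ℂ H2 :=
  (ContinuousLinearMap.norm_map_iff_adjoint_comp_self _).1 (norm_expXP_apply P)

theorem expXP_comp_adjoint (P : ℝ) :
    expXP P ∘L (expXP P).adjoint = ContinuousLinearMap.id ℂ H2 := by
  ext1 ψ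
  obtain ⟨φ, rfl⟩ := expXP_surjective P ψ
  exact congrArg (expXP P) (DFunLike.congr_fun (adjoint_expXP_comp_self P) φ)

theorem adjoint_paritySwap_comp_self :
    paritySwap.adjoint ∘L paritySwap = ContinuousLinearMap.id ℂ H2 :=
  (ContinuousLinearMap.norm_map_iff_adjoint_comp_self _).1
    (Lp.compMeasurePreservingₗᵢ ℂ _ measurePreserving_paritySwap).norm_map

/-- Invariance in the sector `P` means commuting with `exp (i x̂_C (p̂_B - P))`. -/
theorem invariant_iff_commute (P : ℝ) (O : H2 →L[ℂ] H2) : Invariant P O ↔ Commute (expXP P) O := by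
  rw [Invariant, transformation, ContinuousLinearMap.adjoint_comp]
  have hU : (expXP P).adjoint * expXP P = 1 := adjoint_expXP_comp_self P
  have hU' : expXP P * (expXP P).adjoint = 1 := expXP_comp_adjoint P
  have hW : paritySwap.adjoint * paritySwap = 1 := adjoint_paritySwap_comp_self
  change paritySwap * expXP P * (O * ((expXP P).adjoint * paritySwap.adjoint)) =
    paritySwap * (O * paritySwap.adjoint) ↔ expXP P * O = O * expXP P
  constructor
  · intro h
    calc expXP P * O
        = (paritySwap.adjoint * paritySwap) * expXP P * O * ((expXP P).adjoint *
          (paritySwap.adjoint * paritySwap) * expXP P) := by simp [hU, hW]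
      _ = paritySwap.adjoint * (paritySwap * expXP P * (O * ((expXP P).adjoint *
          paritySwap.adjoint))) * paritySwap * expXP P := by simp only [mul_assoc]
      _ = (paritySwap.adjoint * paritySwap) * O * (paritySwap.adjoint * paritySwap) *
          expXP P := by rw [h]; simp only [mul_assoc]
      _ = O * expXP P := by simp [hW]
  · intro h
    calc paritySwap * expXP P * (O * ((expXP P).adjoint * paritySwap.adjoint))
        = paritySwap * (expXP P * O) * (expXP P).adjoint * paritySwap.adjoint := by
          simp only [mul_assoc]
      _ = paritySwap * O * (expXP P * (expXP P).adjoint) * paritySwap.adjoint := by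
          rw [h]; simp only [mul_assoc]
      _ = paritySwap * (O * paritySwap.adjoint) := by simp [hU', mul_assoc]

/-- For an operator invariant in the sector `0`, invariance in the sector `P` means commuting with
the phase. -/
theorem invariant_iff_commute_phaseOp {O : H2 →L[ℂ] H2} (h₀ : Invariant 0 O) (P : ℝ) :
    Invariant P O ↔ Commute (phaseOp P) O := by
  rw [invariant_iff_commute] at h₀ ⊢
  have hU' : expXP 0 * (expXP 0).adjoint = 1 := expXP_comp_adjoint 0
  have hPU : expXP P = phaseOp P * expXP 0 := expXP_eq_phaseOp_comp P
  rw [hPU]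
  -- The unitary `expXP 0` commutes with `O` and is cancelled on the right.
  refine ⟨fun h => ?_, fun h => h.mul_left h₀⟩
  have h₁ : phaseOp P * O * expXP 0 = O * phaseOp P * expXP 0 := by
    rw [mul_assoc, ← h₀.eq, ← mul_assoc, h.eq, mul_assoc]
  have h₂ := congrArg (· * (expXP 0).adjoint) h₁
  simp only [mul_assoc, hU', mul_one] at h₂
  exact h₂

/-! ### Matrix elements of the controlled translation -/

/-- The correlation function `z ↦ ⟨f, T_z g⟩`. -/
def correlation (f g : H1) (z : ℝ) : ℂ := inner ℂ f (translation z g)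

theorem continuous_correlation (f g : H1) : Continuous (correlation f g) :=
  continuous_const.inner (continuous_translation_apply g)

theorem norm_correlation_le (f g : H1) (z : ℝ) : ‖correlation f g z‖ ≤ ‖f‖ * ‖g‖ :=
  (norm_inner_le_norm _ _).trans_eq (by rw [norm_translation_apply])

theorem memLp_top_correlation (f g : H1) : MemLp (correlation f g) ∞ (volume : Measure ℝ) :=
  memLp_top_of_measurable_of_bound (continuous_correlation f g).measurable
    ⟨_, norm_correlation_le f g⟩

/-- Fubini, integrating over `y` first: for fixed `z` the inner integral is the correlation of `f`
with the translate of `f'`. -/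
theorem inner_tensor_expXP_tensor (f g f' g' : H1) :
    inner ℂ (tensor f g) (expXP 0 (tensor f' g')) =
      inner ℂ g (mulOp (correlation f f') g') := by
  have hint := L2.integrable_inner (𝕜 := ℂ) (tensor f g) (expXP 0 (tensor f' g'))
  have hae : (fun q => inner ℂ (tensor f g q) (expXP 0 (tensor f' g') q)) =ᵐ[volume]
      fun q : ℝ × ℝ => inner ℂ (f q.1) (f' (q.1 + q.2)) * inner ℂ (g q.2) (g' q.2) := by
    filter_upwards [tensor_apply f g, expXP_apply 0 (tensor f' g'),
      measurePreserving_shear.quasiMeasurePreserving.ae (tensor_apply f' g')] with q h₁ h₂ h₃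
    rw [h₁, h₂, h₃]
    simp only [RCLike.inner_apply, map_mul, Complex.ofReal_zero, mul_zero, neg_zero,
      Complex.exp_zero, one_mul]
    ring
  rw [inner_mulOp (memLp_top_correlation f f'), L2.inner_def, integral_congr_ae hae,
    Measure.volume_eq_prod, integral_prod_symm _ (by
      rw [← Measure.volume_eq_prod]; exact hint.congr hae)]
  congr 1
  ext z
  dsimp only
  rw [integral_mul_const, correlation, L2.inner_def]
  congr 1
  refine integral_congr_ae ?_
  filter_upwards [translation_apply z f'] with y hy
  rw [hy]

/-! ### Intertwining multiplication operators

A pair of bounded measurable functions `a`, `b` with `M_a K = K M_b` is encoded as one function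
`h = Sum.elim a b` on `ℝ ⊕ ℝ`. -/

/-- `K` intertwines multiplication by the right half of `h` with multiplication by the left half. -/
structure Intertwines (K : H1 →L[ℂ] H1) (h : ℝ ⊕ ℝ → ℂ) : Prop where
  measurable : Measurable h
  bounded : ∃ C, ∀ x, ‖h x‖ ≤ C
  comm : mulOp (h ∘ Sum.inl) ∘L K = K ∘L mulOp (h ∘ Sum.inr)

/-- Dominated convergence: bounded pointwise limits of symbols give weak operator limits, enough to
preserve an intertwining relation. -/
theorem tendsto_inner_mulOp {h : ℕ → ℝ → ℂ} {k : ℝ → ℂ} {C : ℝ} (hm : ∀ n, Measurable (h n))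
    (hC : ∀ n x, ‖h n x‖ ≤ C)
    (hlim : ∀ x, Filter.Tendsto (fun n => h n x) Filter.atTop (nhds (k x))) (f g : H1) :
    Filter.Tendsto (fun n => inner ℂ f (mulOp (h n) g)) Filter.atTop
      (nhds (inner ℂ f (mulOp k g))) := by
  have hkm : Measurable k := measurable_of_tendsto_metrizable hm (tendsto_pi_nhds.2 hlim)
  have hkC (x : ℝ) : ‖k x‖ ≤ C := le_of_tendsto' (hlim x).norm fun n => hC n x
  have hint := L2.integrable_inner (𝕜 := ℂ) f g
  simp_rw [inner_mulOp (memLp_top_of_measurable_of_bound (hm _) ⟨C, hC _⟩),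
    inner_mulOp (memLp_top_of_measurable_of_bound hkm ⟨C, hkC⟩)]
  refine tendsto_integral_of_dominated_convergence (fun x => C * ‖inner ℂ (f x) (g x)‖)
    (fun n => (hm n).aestronglyMeasurable.mul hint.aestronglyMeasurable) (hint.norm.const_mul C)
    (fun n => Filter.Eventually.of_forall fun x => ?_)
    (Filter.Eventually.of_forall fun x => (hlim x).mul_const _)
  rw [norm_mul]
  exact mul_le_mul_of_nonneg_right (hC n x) (norm_nonneg _)

namespace Intertwines

variable {K : H1 →L[ℂ] H1} {h k : ℝ ⊕ ℝ → ℂ}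

theorem memLp_left (hh : Intertwines K h) : MemLp (h ∘ Sum.inl) ∞ (volume : Measure ℝ) :=
  memLp_top_of_measurable_of_bound (hh.measurable.comp measurable_inl)
    (hh.bounded.imp fun _ hC x => hC (Sum.inl x))

theorem memLp_right (hh : Intertwines K h) : MemLp (h ∘ Sum.inr) ∞ (volume : Measure ℝ) :=
  memLp_top_of_measurable_of_bound (hh.measurable.comp measurable_inr)
    (hh.bounded.imp fun _ hC x => hC (Sum.inr x))

theorem const (K : H1 →L[ℂ] H1) (c : ℂ) : Intertwines K fun _ => c where
  measurable := measurable_const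
  bounded := ⟨‖c‖, fun _ => le_rfl⟩
  comm := by
    change mulOp (fun _ => c) ∘L K = K ∘L mulOp (fun _ => c)
    rw [mulOp_const]
    ext1 g
    simp

theorem add (hh : Intertwines K h) (hk : Intertwines K k) : Intertwines K (h + k) where
  measurable := hh.measurable.add hk.measurable
  bounded := by
    obtain ⟨C, hC⟩ := hh.bounded
    obtain ⟨D, hD⟩ := hk.bounded
    exact ⟨C + D, fun x => (norm_add_le _ _).trans (add_le_add (hC x) (hD x))⟩
  comm := by
    change mulOp (h ∘ Sum.inl + k ∘ Sum.inl) ∘L K = K ∘L mulOp (h ∘ Sum.inr + k ∘ Sum.inr)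
    rw [mulOp_add hh.memLp_left hk.memLp_left, mulOp_add hh.memLp_right hk.memLp_right,
      ContinuousLinearMap.add_comp, ContinuousLinearMap.comp_add, hh.comm, hk.comm]

theorem mul (hh : Intertwines K h) (hk : Intertwines K k) : Intertwines K (h * k) where
  measurable := hh.measurable.mul hk.measurable
  bounded := by
    obtain ⟨C, hC⟩ := hh.bounded
    obtain ⟨D, hD⟩ := hk.bounded
    refine ⟨C * D, fun x => (norm_mul _ _).trans_le ?_⟩
    exact mul_le_mul (hC x) (hD x) (norm_nonneg _) ((norm_nonneg _).trans (hC x))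
  comm := by
    change mulOp (h ∘ Sum.inl * k ∘ Sum.inl) ∘L K = K ∘L mulOp (h ∘ Sum.inr * k ∘ Sum.inr)
    rw [mulOp_mul hh.memLp_left hk.memLp_left, mulOp_mul hh.memLp_right hk.memLp_right,
      ContinuousLinearMap.comp_assoc, hk.comm, ← ContinuousLinearMap.comp_assoc, hh.comm,
      ContinuousLinearMap.comp_assoc]

/-- The Fuglede–Putnam theorem for multiplication operators. -/
theorem star (hh : Intertwines K h) : Intertwines K (star h) where
  measurable := Complex.continuous_conj.measurable.comp hh.measurable
  bounded := hh.bounded.imp fun _ hC x => (norm_star (h x)).trans_le (hC x)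
  comm := by
    have hF := fuglede_putnam_rosenblum (isStarNormal_mulOp hh.memLp_right)
      (isStarNormal_mulOp hh.memLp_left) (x := K) hh.comm.symm
    rw [ContinuousLinearMap.star_eq_adjoint, ContinuousLinearMap.star_eq_adjoint,
      adjoint_mulOp hh.memLp_left, adjoint_mulOp hh.memLp_right] at hF
    exact hF.eq.symm

theorem of_tendsto {h : ℕ → ℝ ⊕ ℝ → ℂ} {k : ℝ ⊕ ℝ → ℂ} {C : ℝ} (hh : ∀ n, Intertwines K (h n))
    (hC : ∀ n x, ‖h n x‖ ≤ C)
    (hlim : ∀ x, Filter.Tendsto (fun n => h n x) Filter.atTop (nhds (k x))) :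
    Intertwines K k where
  measurable := measurable_of_tendsto_metrizable (fun n => (hh n).measurable)
    (tendsto_pi_nhds.2 hlim)
  bounded := ⟨C, fun x => le_of_tendsto' (hlim x).norm fun n => hC n x⟩
  comm := by
    ext1 g
    refine ext_inner_left ℂ fun f => ?_
    have hl := tendsto_inner_mulOp (h := fun n => h n ∘ Sum.inl) (k := k ∘ Sum.inl)
      (fun n => (hh n).measurable.comp measurable_inl) (fun n x => hC n (Sum.inl x))
      (fun x => hlim (Sum.inl x)) f (K g)
    have hr := tendsto_inner_mulOp (h := fun n => h n ∘ Sum.inr) (k := k ∘ Sum.inr)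
      (fun n => (hh n).measurable.comp measurable_inr) (fun n x => hC n (Sum.inr x))
      (fun x => hlim (Sum.inr x)) (K.adjoint f) g
    simp_rw [ContinuousLinearMap.adjoint_inner_left] at hr
    refine tendsto_nhds_unique hl (hr.congr fun n => ?_)
    exact congrArg (inner ℂ f) (DFunLike.congr_fun (hh n).comm g).symm

theorem one_sub (hh : Intertwines K h) : Intertwines K (fun x => 1 - h x) := by
  have := (const K 1).add ((const K (-1)).mul hh)
  convert this using 1
  ext x
  simp [sub_eq_add_neg]

theorem re (hh : Intertwines K h) : Intertwines K (fun x => ((h x).re : ℂ)) := by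
  have := (const K (1 / 2)).mul (hh.add hh.star)
  convert this using 1
  ext x
  simp [Complex.re_eq_add_conj, div_eq_inv_mul]

theorem im (hh : Intertwines K h) : Intertwines K (fun x => ((h x).im : ℂ)) := by
  convert ((const K (-Complex.I)).mul hh).re using 3
  simp

theorem polynomial {a : ℝ ⊕ ℝ → ℝ} (ha : Intertwines K fun x => (a x : ℂ))
    (p : Polynomial ℝ) : Intertwines K fun x => ((p.eval (a x) : ℝ) : ℂ) := by
  induction p using Polynomial.induction_on' with
  | add p q hp hq =>
    convert hp.add hq using 1
    ext x
    simp
  | monomial n c =>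
    induction n with
    | zero => simpa using const K (c : ℂ)
    | succ n ih =>
      convert ih.mul ha using 1
      ext x
      simp [pow_succ, mul_assoc]

theorem continuous {a : ℝ ⊕ ℝ → ℝ} (ha : Intertwines K fun x => (a x : ℂ)) {φ : ℝ → ℝ}
    (hφ : Continuous φ) {D : ℝ} (hD : ∀ t, |φ t| ≤ D) :
    Intertwines K fun x => (φ (a x) : ℂ) := by
  obtain ⟨C, hC⟩ := ha.bounded
  have hC' (x : ℝ ⊕ ℝ) : a x ∈ Set.Icc (-C) C := abs_le.1 (by simpa using hC x)
  choose p hp using fun n : ℕ => exists_polynomial_near_of_continuousOn (-C) C φ hφ.continuousOn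
    (1 / ((n : ℝ) + 1)) Nat.one_div_pos_of_nat
  -- On `[-C, C]`, which contains the values of `a`, the polynomials are within `1 / (n + 1) ≤ 1` of
  -- `φ`; hence the uniform bound `D + 1`.
  refine of_tendsto (C := D + 1) (fun n => ha.polynomial (p n)) (fun n x => ?_) fun x => ?_
  · rw [Complex.norm_real, Real.norm_eq_abs]
    have h₁ := (hp n _ (hC' x)).le.trans (Nat.one_div_le_one_div (Nat.zero_le n))
    have h₂ := abs_sub_abs_le_abs_sub ((p n).eval (a x)) (φ (a x))
    have h₃ := hD (a x)
    norm_num at h₁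
    linarith
  · refine (Complex.continuous_ofReal.tendsto _).comp ?_
    rw [tendsto_iff_dist_tendsto_zero]
    exact squeeze_zero (fun n => dist_nonneg)
      (fun n => by rw [Real.dist_eq]; exact (hp n _ (hC' x)).le)
      tendsto_one_div_add_atTop_nhds_zero_nat

theorem indicator_Iic {a : ℝ ⊕ ℝ → ℝ} (ha : Intertwines K fun x => (a x : ℂ)) (t : ℝ) :
    Intertwines K ((a ⁻¹' Set.Iic t).indicator 1) := by
  -- A ramp equal to `1` for `s ≤ t` and to `0` once `n ≥ 1 / (s - t)` for `s > t`.
  let φ (n : ℕ) (s : ℝ) : ℝ := max 0 (min 1 (1 - n * (s - t)))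
  have hφ (n : ℕ) (s : ℝ) : |φ n s| ≤ 1 := by
    rw [abs_of_nonneg (le_max_left _ _)]
    exact max_le zero_le_one (min_le_left _ _)
  refine of_tendsto (C := 1) (fun n => ha.continuous (φ := φ n) (by fun_prop) (hφ n))
    (fun n x => ?_) fun x => ?_
  · rw [Complex.norm_real]
    exact hφ n _
  · by_cases hx : a x ≤ t
    · refine tendsto_const_nhds.congr fun n => ?_
      have h₁ : (1 : ℝ) ≤ 1 - n * (a x - t) := by
        have := mul_nonneg (Nat.cast_nonneg (α := ℝ) n) (sub_nonneg.2 hx)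
        linarith
      simp [φ, hx, min_eq_left h₁]
    · obtain ⟨N, hN⟩ := exists_nat_ge (1 / (a x - t))
      refine tendsto_const_nhds.congr' ?_
      filter_upwards [Filter.eventually_ge_atTop N] with n hn
      have hpos : 0 < a x - t := sub_pos.2 (not_le.1 hx)
      have h₁ : 1 - n * (a x - t) ≤ 0 := by
        have h₂ : 1 / (a x - t) ≤ n := hN.trans (Nat.cast_le.2 hn)
        rw [div_le_iff₀ hpos] at h₂
        linarith
      simp [φ, hx, min_eq_right (h₁.trans zero_le_one), max_eq_left h₁]

theorem indicator_union {s t : Set (ℝ ⊕ ℝ)} (hs : Intertwines K (s.indicator 1))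
    (ht : Intertwines K (t.indicator 1)) : Intertwines K ((s ∪ t).indicator 1) := by
  convert (hs.one_sub.mul ht.one_sub).one_sub using 1
  ext x
  by_cases h₁ : x ∈ s <;> by_cases h₂ : x ∈ t <;> simp [Set.indicator, h₁, h₂]

end Intertwines

/-- The σ-algebra of the sets in `ℝ ⊕ ℝ` whose indicator functions are intertwined by `K`. -/
@[reducible] def intertwinedSets (K : H1 →L[ℂ] H1) : MeasurableSpace (ℝ ⊕ ℝ) where
  MeasurableSet' s := Intertwines K (s.indicator 1)
  measurableSet_empty := by
    simpa [Set.indicator_empty] using Intertwines.const K 0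
  measurableSet_compl s hs := by
    convert hs.one_sub using 1
    ext x
    by_cases h : x ∈ s <;> simp [h]
  measurableSet_iUnion f hf := by
    -- The indicators of the finite unions converge pointwise to that of the whole union.
    have hacc (n : ℕ) : Intertwines K ((Set.accumulate f n).indicator 1) := by
      induction n with
      | zero => simpa using hf 0
      | succ n ih =>
        rw [Set.accumulate_succ]
        exact ih.indicator_union (hf _)
    refine Intertwines.of_tendsto (C := 1) hacc (fun n x => ?_) fun x => ?_
    · by_cases h : x ∈ Set.accumulate f n <;> simp [h]
    · rw [← Set.iUnion_accumulate]
      exact (Set.monotone_accumulate.tendsto_indicator _ _ x).mono_right (pure_le_nhds _)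

/-- Fuglede–Putnam enters here: it lets the real and imaginary parts be intertwined separately, and
their sublevel sets suffice. -/
theorem Intertwines.measurable_intertwinedSets {K : H1 →L[ℂ] H1} {h : ℝ ⊕ ℝ → ℂ}
    (hh : Intertwines K h) : Measurable[intertwinedSets K] h := by
  refine @measurable_of_re_im _ _ _ (intertwinedSets K) _ ?_ ?_
  · exact @measurable_of_Iic _ _ _ _ _ (intertwinedSets K) _ _ _ _ fun t => hh.re.indicator_Iic t
  · exact @measurable_of_Iic _ _ _ _ _ (intertwinedSets K) _ _ _ _ fun t => hh.im.indicator_Iic t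

theorem intertwines_simpleFunc {K : H1 →L[ℂ] H1} (f : @SimpleFunc (ℝ ⊕ ℝ) (intertwinedSets K) ℂ) :
    Intertwines K f := by
  induction f using SimpleFunc.induction with
  | const c hs =>
    convert (Intertwines.const K c).mul hs using 1
    ext x
    simp [Set.indicator]
  | add _ hf hg => exact hf.add hg

/-- The converse direction, by uniformly bounded simple functions. Through it, functions that factor
measurably through intertwined ones become intertwined. -/
theorem intertwines_of_measurable {K : H1 →L[ℂ] H1} {h : ℝ ⊕ ℝ → ℂ}
    (hm : Measurable[intertwinedSets K] h) {C : ℝ} (hC : ∀ x, ‖h x‖ ≤ C) : Intertwines K h := by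
  have hs : StronglyMeasurable[intertwinedSets K] h := hm.stronglyMeasurable
  have h₀ : 0 ≤ C := (norm_nonneg _).trans (hC (Sum.inl 0))
  exact Intertwines.of_tendsto (fun n => intertwines_simpleFunc (hs.approxBounded C n))
    (fun n x => hs.norm_approxBounded_le h₀ n x)
    fun x => hs.tendsto_approxBounded_of_norm_le (hC x)

/-! ### Translations related by a bounded operator -/

/-- `T_z A = A T_{z'}`. -/
def TranslationRel (A : H1 →L[ℂ] H1) (z z' : ℝ) : Prop :=
  translation z ∘L A = A ∘L translation z'

namespace TranslationRel

variable {A : H1 →L[ℂ] H1} {a a' b b' : ℝ}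

theorem zero (A : H1 →L[ℂ] H1) : TranslationRel A 0 0 := by
  rw [TranslationRel, translation_zero]
  rfl

theorem add (h : TranslationRel A a a') (k : TranslationRel A b b') :
    TranslationRel A (a + b) (a' + b') := by
  rw [TranslationRel, translation_add, add_comm a' b', translation_add,
    ContinuousLinearMap.comp_assoc, k, ← ContinuousLinearMap.comp_assoc, h]
  have := translation_add a' b'
  rw [add_comm, translation_add] at this
  rw [ContinuousLinearMap.comp_assoc, this]

theorem neg (h : TranslationRel A a a') : TranslationRel A (-a) (-a') := by
  ext1 f
  have h₁ := DFunLike.congr_fun h (translation (-a') f)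
  simp only [ContinuousLinearMap.comp_apply] at h₁ ⊢
  rw [← translation_add_apply, add_neg_cancel, translation_zero,
    ContinuousLinearMap.id_apply] at h₁
  rw [← h₁, translation_neg_apply_self]

/-- The relation is symmetric for multiples of self-adjoint operators. -/
theorem symm {c : ℂ} (hA : A = c • A.adjoint) (h : TranslationRel A a a') :
    TranslationRel A a' a := by
  have h₁ := congrArg ContinuousLinearMap.adjoint h.neg
  rw [ContinuousLinearMap.adjoint_comp, ContinuousLinearMap.adjoint_comp, adjoint_translation,
    adjoint_translation, neg_neg, neg_neg] at h₁
  rw [TranslationRel, hA, ContinuousLinearMap.comp_smul, ContinuousLinearMap.smul_comp, h₁]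

/-- From `A = A T_a`, the range of the adjoint consists of `a`-periodic functions, which vanish in
`L²` if `a ≠ 0`. -/
theorem eq_zero_of_zero_left (hA : A ≠ 0) (h : TranslationRel A 0 a) : a = 0 := by
  by_contra ha
  refine hA (ContinuousLinearMap.adjoint.injective ?_)
  rw [map_zero]
  ext1 f
  have h₁ := congrArg ContinuousLinearMap.adjoint h
  rw [translation_zero, ContinuousLinearMap.id_comp, ContinuousLinearMap.adjoint_comp,
    adjoint_translation] at h₁
  exact eq_zero_of_translation_eq_self (neg_ne_zero.2 ha) (DFunLike.congr_fun h₁ f).symm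

theorem eq_zero_of_zero_right (hA : A ≠ 0) (h : TranslationRel A a 0) : a = 0 := by
  by_contra ha
  refine hA ?_
  ext1 f
  rw [TranslationRel, translation_zero, ContinuousLinearMap.comp_id] at h
  exact eq_zero_of_translation_eq_self ha (DFunLike.congr_fun h f)

end TranslationRel

/-- The `a` with `T_a A = A T_{ε a}`. -/
def relSubgroup (A : H1 →L[ℂ] H1) (ε : ℝ) : AddSubgroup ℝ where
  carrier := {a | TranslationRel A a (ε * a)}
  add_mem' {a b} ha hb := by
    change TranslationRel A (a + b) (ε * (a + b))
    rw [mul_add]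
    exact ha.add hb
  zero_mem' := by
    change TranslationRel A 0 (ε * 0)
    rw [mul_zero]
    exact TranslationRel.zero A
  neg_mem' {a} ha := by
    change TranslationRel A (-a) (ε * -a)
    rw [mul_neg]
    exact ha.neg

theorem mem_relSubgroup {A : H1 →L[ℂ] H1} {ε a : ℝ} :
    a ∈ relSubgroup A ε ↔ TranslationRel A a (ε * a) := Iff.rfl

theorem isClosed_relSubgroup (A : H1 →L[ℂ] H1) (ε : ℝ) :
    IsClosed (relSubgroup A ε : Set ℝ) := by
  have : (relSubgroup A ε : Set ℝ) =
      ⋂ f : H1, {a | translation a (A f) = A (translation (ε * a) f)} := by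
    ext a
    simp only [SetLike.mem_coe, mem_relSubgroup, Set.mem_iInter, Set.mem_ofPred_eq]
    exact ContinuousLinearMap.ext_iff
  rw [this]
  exact isClosed_iInter fun f => isClosed_eq (continuous_translation_apply _)
    (A.continuous.comp ((continuous_translation_apply f).comp (continuous_const_mul ε)))

/-- A subgroup of `ℝ` is dense or cyclic, and this one is closed by strong continuity of
translations. -/
theorem relSubgroup_eq_top_or_countable (A : H1 →L[ℂ] H1) (ε : ℝ) :
    (∀ a, TranslationRel A a (ε * a)) ∨ (relSubgroup A ε : Set ℝ).Countable := by
  rcases AddSubgroup.dense_or_cyclic (relSubgroup A ε) with h | ⟨a, h⟩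
  · left
    intro a
    have := (isClosed_relSubgroup A ε).closure_eq.symm.trans h.closure_eq
    exact (Set.eq_univ_iff_forall.1 this) a
  · right
    rw [h, ← AddSubgroup.zmultiples_eq_closure, AddSubgroup.coe_zmultiples]
    exact Set.countable_range _

/-- By symmetry, a related pair `(z, z')` puts `z + z'` in the subgroup for `ε = 1` and `z - z'` in
that for `ε = -1`; `z` is half the sum of these two numbers. -/
theorem forall_translationRel_or_countable {A : H1 →L[ℂ] H1} {c : ℂ} (hA : A = c • A.adjoint) :
    (∃ ε : ℝ, (ε = 1 ∨ ε = -1) ∧ ∀ a, TranslationRel A a (ε * a)) ∨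
      {z | ∃ z', TranslationRel A z z'}.Countable := by
  rcases relSubgroup_eq_top_or_countable A 1 with h | h₁
  · exact Or.inl ⟨1, Or.inl rfl, h⟩
  rcases relSubgroup_eq_top_or_countable A (-1) with h | h₂
  · exact Or.inl ⟨-1, Or.inr rfl, h⟩
  right
  refine ((h₁.prod h₂).image fun q => (q.1 + q.2) / 2).mono ?_
  rintro z ⟨z', h⟩
  refine ⟨(z + z', z - z'), ⟨?_, ?_⟩, by ring⟩
  · change TranslationRel A (z + z') (1 * (z + z'))
    convert h.add (h.symm hA) using 1
    ring
  · change TranslationRel A (z - z') (-1 * (z - z'))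
    convert h.add (h.symm hA).neg using 1 <;> ring

/-! ### Locality -/

instance : Fact ((2 : ℝ≥0∞) ≠ ∞) := ⟨ENNReal.ofNat_ne_top⟩

/-- The matrix elements of `T_z A` and of `A T_z` with respect to a dense sequence. -/
def matrixElements (A : H1 →L[ℂ] H1) (x : ℝ ⊕ ℝ) (q : ℕ × ℕ) : ℂ :=
  Sum.elim (correlation (TopologicalSpace.denseSeq H1 q.1) (A (TopologicalSpace.denseSeq H1 q.2)))
    (correlation (A.adjoint (TopologicalSpace.denseSeq H1 q.1)) (TopologicalSpace.denseSeq H1 q.2))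
    x

theorem eq_of_inner_denseSeq {A B : H1 →L[ℂ] H1}
    (h : ∀ i j, inner ℂ (TopologicalSpace.denseSeq H1 i) (A (TopologicalSpace.denseSeq H1 j)) =
      inner ℂ (TopologicalSpace.denseSeq H1 i) (B (TopologicalSpace.denseSeq H1 j))) : A = B := by
  have hd := TopologicalSpace.denseRange_denseSeq H1
  refine ContinuousLinearMap.coeFn_injective
    (hd.equalizer A.continuous B.continuous (funext fun j => ?_))
  refine ext_inner_left ℂ fun f => ?_
  have hl : Continuous fun f : H1 => inner ℂ f (A (TopologicalSpace.denseSeq H1 j)) := by fun_prop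
  have hr : Continuous fun f : H1 => inner ℂ f (B (TopologicalSpace.denseSeq H1 j)) := by fun_prop
  exact congrFun (hd.equalizer hl hr (funext fun i => h i j)) f

/-- The operator whose matrix elements are `matrixElements`. -/
def translated (A : H1 →L[ℂ] H1) : ℝ ⊕ ℝ → H1 →L[ℂ] H1 :=
  Sum.elim (fun z => translation z ∘L A) fun z => A ∘L translation z

theorem matrixElements_eq_inner (A : H1 →L[ℂ] H1) (x : ℝ ⊕ ℝ) (q : ℕ × ℕ) :
    matrixElements A x q = inner ℂ (TopologicalSpace.denseSeq H1 q.1)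
      (translated A x (TopologicalSpace.denseSeq H1 q.2)) := by
  rcases x with z | z
  · rfl
  · exact ContinuousLinearMap.adjoint_inner_left A _ _

theorem matrixElements_eq_iff {A : H1 →L[ℂ] H1} {x y : ℝ ⊕ ℝ} :
    matrixElements A x = matrixElements A y ↔ translated A x = translated A y := by
  constructor
  · intro h
    refine eq_of_inner_denseSeq fun i j => ?_
    have := congrFun h (i, j)
    rwa [matrixElements_eq_inner, matrixElements_eq_inner] at this
  · intro h
    ext q
    rw [matrixElements_eq_inner, matrixElements_eq_inner, h]

/-- Lusin–Souslin: a continuous injection between Polish spaces is a Borel embedding. Countably many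
matrix elements keep the target Polish; injectivity holds since no `T_a` with `a ≠ 0` fixes `A`. -/
theorem measurableEmbedding_matrixElements_inl {A : H1 →L[ℂ] H1} (hA : A ≠ 0) :
    MeasurableEmbedding fun z => matrixElements A (Sum.inl z) := by
  refine Continuous.measurableEmbedding
    (continuous_pi fun q => continuous_correlation _ _) fun z z' h => ?_
  have h₁ : translation z ∘L A = translation z' ∘L A := matrixElements_eq_iff.1 h
  refine sub_eq_zero.1 (TranslationRel.eq_zero_of_zero_right hA (a := z - z') ?_)
  rw [TranslationRel, sub_eq_neg_add, translation_add, ContinuousLinearMap.comp_assoc, h₁,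
    ← ContinuousLinearMap.comp_assoc, ← translation_add, neg_add_cancel, translation_zero]
  rfl

theorem measurableEmbedding_matrixElements_inr {A : H1 →L[ℂ] H1} (hA : A ≠ 0) :
    MeasurableEmbedding fun z => matrixElements A (Sum.inr z) := by
  refine Continuous.measurableEmbedding
    (continuous_pi fun q => continuous_correlation _ _) fun z z' h => ?_
  have h₁ : A ∘L translation z = A ∘L translation z' := matrixElements_eq_iff.1 h
  refine sub_eq_zero.1 (TranslationRel.eq_zero_of_zero_left hA (a := z - z') ?_)
  rw [TranslationRel, sub_eq_add_neg, translation_add, ← ContinuousLinearMap.comp_assoc, h₁,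
    ContinuousLinearMap.comp_assoc, ← translation_add, add_neg_cancel, translation_zero]
  rfl

section

variable {A K : H1 →L[ℂ] H1}

theorem measurable_matrixElements (hAK : ∀ f g, mulOp (correlation f (A g)) ∘L K =
      K ∘L mulOp (correlation (A.adjoint f) g)) :
    Measurable[intertwinedSets K] (matrixElements A) := by
  refine @measurable_pi_lambda _ _ _ (intertwinedSets K) _ _ fun q =>
    Intertwines.measurable_intertwinedSets ⟨?_, ?_, hAK _ _⟩
  · exact measurable_fun_sum (continuous_correlation _ _).measurable
      (continuous_correlation _ _).measurable
  · refine ⟨max (‖TopologicalSpace.denseSeq H1 q.1‖ * ‖A (TopologicalSpace.denseSeq H1 q.2)‖)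
      (‖A.adjoint (TopologicalSpace.denseSeq H1 q.1)‖ * ‖TopologicalSpace.denseSeq H1 q.2‖), ?_⟩
    rintro (z | z)
    · exact (norm_correlation_le _ _ z).trans (le_max_left _ _)
    · exact (norm_correlation_le _ _ z).trans (le_max_right _ _)

/-- The translations related by `A` are uncountably many. -/
theorem eq_zero_of_countable (hA : A ≠ 0) (hAK : ∀ f g, mulOp (correlation f (A g)) ∘L K =
      K ∘L mulOp (correlation (A.adjoint f) g))
    (hc : {z | ∃ z', TranslationRel A z z'}.Countable) : K = 0 := by
  -- The left part of this set is `{z | ∃ z', T_z A = A T_{z'}}`, which is null; the right part is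
  -- all of `ℝ`. Intertwining the indicators then reads `0 = K`.
  have hs := measurable_matrixElements hAK
    (measurableEmbedding_matrixElements_inr hA).measurableSet_range
  have h := Intertwines.comm hs
  have hl : mulOp (Set.indicator (matrixElements A ⁻¹'
      Set.range fun z => matrixElements A (Sum.inr z)) 1 ∘ Sum.inl) = 0 := by
    refine mulOp_eq_zero_of_ae ?_
    filter_upwards [hc.ae_notMem volume] with z hz
    refine Set.indicator_of_notMem ?_ _
    rintro ⟨z', hz'⟩
    exact hz ⟨z', (matrixElements_eq_iff.1 hz').symm⟩
  have hr : Set.indicator (matrixElements A ⁻¹'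
      Set.range fun z => matrixElements A (Sum.inr z)) 1 ∘ Sum.inr = fun _ => (1 : ℂ) := by
    ext z
    rw [Function.comp_apply, Set.indicator_of_mem, Pi.one_apply]
    exact ⟨z, rfl⟩
  rw [hl, hr, mulOp_const, one_smul, ContinuousLinearMap.comp_id] at h
  rw [← h, ContinuousLinearMap.zero_comp]

/-- If `T_a A = A T_{ε a}` for all `a`, then `K` carries `M_{h (ε ·)}` to `M_h`. -/
theorem mulOp_comp_eq (hA : A ≠ 0) (hAK : ∀ f g, mulOp (correlation f (A g)) ∘L K =
      K ∘L mulOp (correlation (A.adjoint f) g)) {ε : ℝ} (hε : ε = 1 ∨ ε = -1)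
    (hrel : ∀ a, TranslationRel A a (ε * a)) {h : ℝ → ℂ} (hm : Measurable h) {C : ℝ}
    (hC : ∀ x, ‖h x‖ ≤ C) : mulOp h ∘L K = K ∘L mulOp fun x => h (ε * x) := by
  have hεε : ε * ε = 1 := by rcases hε with rfl | rfl <;> norm_num
  have hemb := measurableEmbedding_matrixElements_inl hA
  -- This function factors through `matrixElements A`, because `A T_z = T_{ε z} A` identifies the
  -- right point `z` with the left point `ε z`.
  have hmeas : Measurable[intertwinedSets K] (Sum.elim h fun x => h (ε * x)) := by
    intro S hS
    convert measurable_matrixElements hAK (hemb.measurableSet_image.2 (hm hS)) using 1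
    ext x
    rcases x with z | z
    · exact (hemb.injective.mem_set_image (s := h ⁻¹' S)).symm
    · have h₁ : matrixElements A (Sum.inr z) = matrixElements A (Sum.inl (ε * z)) := by
        refine matrixElements_eq_iff.2 (Eq.symm ?_)
        have := hrel (ε * z)
        rw [← mul_assoc, hεε, one_mul] at this
        exact this
      rw [Set.mem_preimage, Set.mem_preimage, h₁]
      exact (hemb.injective.mem_set_image (s := h ⁻¹' S)).symm
  refine (intertwines_of_measurable hmeas (C := C) ?_).comm
  rintro (z | z)
  exacts [hC z, hC _]

end

/-! ### The momentum operator generates the translations -/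

/-- The bilinear pairing `∫ φ f` of a Schwartz function with a function in `L²(ℝ)`. -/
def pairing (φ : 𝓢(ℝ, ℂ)) : H1 →L[ℂ] ℂ :=
  (ContinuousLinearMap.mul ℂ ℂ).lpPairing volume 2 2 (φ.toLp 2 volume)

theorem pairing_apply (φ : 𝓢(ℝ, ℂ)) (f : H1) : pairing φ f = ∫ x, φ x * f x := by
  rw [pairing, ContinuousLinearMap.lpPairing_eq_integral]
  refine integral_congr_ae ?_
  filter_upwards [φ.coeFn_toLp 2 volume] with x hx
  rw [hx, ContinuousLinearMap.mul_apply']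

theorem toDist_apply (f : H1) (φ : 𝓢(ℝ, ℂ)) : toDist f φ = pairing φ f := by
  rw [pairing_apply]
  exact Lp.toTemperedDistribution_apply f φ

theorem eq_of_forall_pairing {f g : H1} (h : ∀ φ, pairing φ f = pairing φ g) : f = g := by
  refine toDist_injective ?_
  ext φ
  rw [toDist_apply, toDist_apply, h]

theorem distDeriv_apply (f : H1) (φ : 𝓢(ℝ, ℂ)) :
    distDeriv f φ = -pairing (SchwartzMap.derivCLM ℂ ℂ φ) f := by
  change toDist f (-(SchwartzMap.derivCLM ℂ ℂ) φ) = _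
  rw [map_neg, toDist_apply]

theorem pairing_translation (φ : 𝓢(ℝ, ℂ)) (f : H1) (z : ℝ) :
    pairing φ (translation z f) = pairing (φ.compSubConstCLM ℂ z) f := by
  rw [pairing_apply, pairing_apply, 
    ← integral_add_right_eq_self (fun x => φ.compSubConstCLM ℂ z x * f x) z]
  refine integral_congr_ae ?_
  filter_upwards [translation_apply z f] with x hx
  rw [hx, SchwartzMap.compSubConstCLM_apply, add_sub_cancel_right]

/-- Supplies an `L²` majorant, uniform over small translations, for differentiating `∫ φ(x - z) f(x)
dx` under the integral. -/
theorem norm_apply_sub_le (φ : 𝓢(ℝ, ℂ)) :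
    ∃ C, ∀ x z : ℝ, |z| ≤ 1 → ‖φ (x - z)‖ ≤ C * (1 + ‖x‖) ^ (-1 : ℝ) := by
  refine ⟨2 * (2 ^ 1 * ((Finset.Iic (1, 0)).sup fun m => SchwartzMap.seminorm ℂ m.1 m.2) φ),
    fun x z hz => ?_⟩
  have h := SchwartzMap.one_add_le_sup_seminorm_apply (𝕜 := ℂ) (m := (1, 0)) (k := 1) (n := 0)
    le_rfl le_rfl φ (x - z)
  rw [norm_iteratedFDeriv_zero, pow_one] at h
  have hx : 1 + ‖x‖ ≤ 2 * (1 + ‖x - z‖) := by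
    have := norm_add_le (x - z) z
    rw [sub_add_cancel, Real.norm_eq_abs z] at this
    linarith [norm_nonneg (x - z)]
  have hpos : 0 < 1 + ‖x‖ := by positivity
  rw [Real.rpow_neg_one, ← div_eq_mul_inv, le_div_iff₀ hpos]
  calc ‖φ (x - z)‖ * (1 + ‖x‖) ≤ ‖φ (x - z)‖ * (2 * (1 + ‖x - z‖)) := by gcongr
    _ = 2 * ((1 + ‖x - z‖) * ‖φ (x - z)‖) := by ring
    _ ≤ _ := by gcongr

theorem memLp_one_add_norm_inv :
    MemLp (fun x : ℝ => (1 + ‖x‖) ^ (-1 : ℝ)) 2 (volume : Measure ℝ) := by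
  have hm : AEStronglyMeasurable (fun x : ℝ => (1 + ‖x‖) ^ (-1 : ℝ)) volume :=
    (Continuous.rpow_const (by fun_prop) fun x => Or.inl (by positivity)).aestronglyMeasurable
  refine (memLp_two_iff_integrable_sq hm).2 ?_
  refine (integrable_one_add_norm (E := ℝ) (μ := volume) (r := 2) (by simp)).congr
    (Filter.Eventually.of_forall fun x => ?_)
  dsimp only
  rw [← Real.rpow_natCast, ← Real.rpow_mul (by positivity)]
  norm_num

theorem hasDerivAt_pairing_translation_zero (φ : 𝓢(ℝ, ℂ)) (f : H1) :
    HasDerivAt (fun z => pairing φ (translation z f)) (distDeriv f φ) 0 := by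
  obtain ⟨C, hC⟩ := norm_apply_sub_le (SchwartzMap.derivCLM ℂ ℂ φ)
  have hf : AEStronglyMeasurable f volume := Lp.aestronglyMeasurable f
  have key := hasDerivAt_integral_of_dominated_loc_of_deriv_le (𝕜 := ℝ) (μ := (volume : Measure ℝ))
    (F := fun z x => φ (x - z) * f x)
    (F' := fun z x => -SchwartzMap.derivCLM ℂ ℂ φ (x - z) * f x) (x₀ := 0)
    (bound := fun x => C * (1 + ‖x‖) ^ (-1 : ℝ) * ‖f x‖)
    (Metric.closedBall_mem_nhds (0 : ℝ) one_pos)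
    (Filter.Eventually.of_forall fun z =>
      (φ.continuous.comp (continuous_id.sub continuous_const)).aestronglyMeasurable.mul hf)
    ?_ ?_ ?_ ?_ ?_
  · have h₁ : distDeriv f φ = ∫ x, -SchwartzMap.derivCLM ℂ ℂ φ (x - 0) * f x := by
      rw [distDeriv_apply, pairing_apply, ← integral_neg]
      simp
    rw [h₁]
    refine key.2.congr_of_eventuallyEq (Filter.Eventually.of_forall fun z => ?_)
    dsimp only
    rw [pairing_translation, pairing_apply]
    rfl
  · simp only [sub_zero]
    exact (φ.memLp 2 volume).integrable_mul (Lp.memLp f)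
  · exact (((SchwartzMap.derivCLM ℂ ℂ φ).continuous.comp
      (continuous_id.sub continuous_const)).neg.aestronglyMeasurable).mul hf
  · refine Filter.Eventually.of_forall fun x z hz => ?_
    rw [norm_mul, norm_neg]
    refine mul_le_mul_of_nonneg_right (hC x z ?_) (norm_nonneg _)
    simpa using hz
  · exact (memLp_one_add_norm_inv.const_mul C).integrable_mul (Lp.memLp f).norm
  · refine Filter.Eventually.of_forall fun x z _ => ?_
    have h₁ : HasDerivAt (fun z : ℝ => x - z) (-1) z := by
      simpa using (hasDerivAt_id z).const_sub x
    have h₂ := (φ.hasDerivAt (x - z)).scomp z h₁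
    rw [neg_smul, one_smul] at h₂
    exact h₂.mul_const (f x)

theorem hasDerivAt_pairing_translation (φ : 𝓢(ℝ, ℂ)) (f : H1) (z : ℝ) :
    HasDerivAt (fun z => pairing φ (translation z f))
      (distDeriv f (φ.compSubConstCLM ℂ z)) z := by
  have h := hasDerivAt_pairing_translation_zero (φ.compSubConstCLM ℂ z) f
  rw [← sub_self z] at h
  have h' := h.comp_sub_const z z
  refine h'.congr_of_eventuallyEq (Filter.Eventually.of_forall fun t => ?_)
  dsimp only
  rw [← pairing_translation, ← translation_add_apply, add_sub_cancel]

/-- The fundamental theorem of calculus for functions in `H¹(ℝ)`. -/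
theorem translation_sub_eq_integral {f g : H1} (h : distDeriv f = toDist g) (z : ℝ) :
    translation z f - f = ∫ s in 0..z, translation s g := by
  have hcont := continuous_translation_apply g
  refine eq_of_forall_pairing fun φ => ?_
  have hderiv (t : ℝ) : HasDerivAt (fun z => pairing φ (translation z f))
      (pairing φ (translation t g)) t := by
    have := hasDerivAt_pairing_translation φ f t
    rwa [h, toDist_apply, ← pairing_translation] at this
  have hint : IntervalIntegrable (fun t => pairing φ (translation t g)) volume 0 z :=
    ((pairing φ).continuous.comp hcont).intervalIntegrable _ _
  rw [← ContinuousLinearMap.intervalIntegral_comp_comm _ (hcont.intervalIntegrable _ _),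
    intervalIntegral.integral_eq_sub_of_hasDerivAt (fun t _ => hderiv t) hint,
    translation_zero, map_sub, ContinuousLinearMap.id_apply]

/-- With `translation_sub_eq_integral` this describes `H¹` by an integral identity in `L²`. Bounded
operators can be applied to that identity, so invariance of the domain need not be shown separately.
-/
theorem distDeriv_eq_of_translation_sub_eq_integral {f g : H1}
    (h : ∀ z, translation z f - f = ∫ s in 0..z, translation s g) : distDeriv f = toDist g := by
  have hcont := continuous_translation_apply g
  ext φ
  refine (hasDerivAt_pairing_translation_zero φ f).unique ?_
  have h₁ := (pairing φ).hasFDerivAt.restrictScalars ℝ |>.comp_hasDerivAt (0 : ℝ)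
    (hcont.integral_hasStrictDerivAt 0 0).hasDerivAt
  have h₂ := h₁.add_const (pairing φ f)
  convert h₂ using 1
  · ext z
    simp only [Function.comp_apply]
    rw [← h z, map_sub, sub_add_cancel]
  · rw [toDist_apply, translation_zero]
    rfl

/-- An operator with `T_a A = A T_{ε a}` for all `a` satisfies `p̂ A = ε A p̂`. -/
theorem momentum_apply_of_translationRel {A : H1 →L[ℂ] H1} {ε : ℝ}
    (hrel : ∀ a, TranslationRel A a (ε * a)) (f : momentum.domain) :
    ∃ h : A f ∈ momentum.domain, momentum ⟨A f, h⟩ = (ε : ℂ) • A (momentum f) := by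
  let g : H1 := weakDeriv f
  have hg : distDeriv (f : H1) = toDist g := (toDist_weakDeriv f).symm
  have hcont := continuous_translation_apply g
  have key : distDeriv (A f) = toDist ((ε : ℂ) • A g) := by
    -- `T_z A f - A f = A (T_{ε z} f - f) = A ∫_0^{ε z} T_s g ds = ε ∫_0^z A T_{ε s} g ds`.
    refine distDeriv_eq_of_translation_sub_eq_integral fun z => ?_
    have h₁ : translation z (A f) = A (translation (ε * z) f) := 
      DFunLike.congr_fun (hrel z) (f : H1)
    have h₂ (s : ℝ) : translation s ((ε : ℂ) • A g) = ε • A (translation (ε * s) g) := by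
      rw [map_smul, Complex.coe_smul]
      exact congrArg (ε • ·) (DFunLike.congr_fun (hrel s) g)
    simp_rw [h₂]
    rw [h₁, ← map_sub, translation_sub_eq_integral hg, intervalIntegral.integral_smul,
      intervalIntegral.smul_integral_comp_mul_left (fun s => A (translation s g)), mul_zero,
      ContinuousLinearMap.intervalIntegral_comp_comm _ (hcont.intervalIntegrable _ _)]
  have hmem : A f ∈ sobolev := ⟨_, key.symm⟩
  refine ⟨hmem, ?_⟩
  have hw : weakDeriv ⟨A f, hmem⟩ = (ε : ℂ) • A g :=
    toDist_injective ((toDist_weakDeriv ⟨A f, hmem⟩).trans key)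
  change (-Complex.I) • weakDeriv ⟨A f, hmem⟩ = (ε : ℂ) • A ((-Complex.I) • g)
  rw [hw, map_smul, smul_comm]

/-! ### The position operator -/

theorem position_apply (f : position.domain) :
    ∀ᵐ x : ℝ, position f x = (x : ℂ) * (f : H1) x :=
  MemLp.coeFn_toLp f.2

/-- An operator with `M_h K = K M_{h (ε ·)}` for all bounded `h` satisfies `x̂ K = ε K x̂`. -/
theorem position_apply_of_mulOp_comp {K : H1 →L[ℂ] H1} {ε : ℝ} (hε : ε = 1 ∨ ε = -1)
    (hK : ∀ h : ℝ → ℂ, Measurable h → (∃ C, ∀ x, ‖h x‖ ≤ C) →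
      mulOp h ∘L K = K ∘L mulOp fun x => h (ε * x)) (f : position.domain) :
    ∃ h : K f ∈ position.domain, position ⟨K f, h⟩ = (ε : ℂ) • K (position f) := by
  have hae (n : ℕ) : ∀ᵐ x : ℝ, x ∈ Set.Icc (-n : ℝ) n →
      (x : ℂ) * (K f) x = ((ε : ℂ) • K (position f)) x := by
    -- The cutoff is symmetric, so `u` is unchanged under `x ↦ ε x` while `v`, the truncated
    -- position, picks up the factor `ε`.
    let I : Set ℝ := Set.Icc (-n : ℝ) n
    let u : ℝ → ℂ := I.indicator 1
    let v : ℝ → ℂ := I.indicator fun x => (x : ℂ)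
    have hI : MeasurableSet I := measurableSet_Icc
    have hum : Measurable u := measurable_one.indicator hI
    have hvm : Measurable v := Complex.measurable_ofReal.indicator hI
    have hub : ∃ C, ∀ x, ‖u x‖ ≤ C := ⟨1, fun x => by by_cases h : x ∈ I <;> simp [u, h]⟩
    have hvb : ∃ C, ∀ x, ‖v x‖ ≤ C := by
      refine ⟨n, fun x => ?_⟩
      by_cases h : x ∈ I
      · simpa [v, h] using abs_le.2 h
      · simp [v, h]
    have hIε (x : ℝ) : ε * x ∈ I ↔ x ∈ I := by
      rcases hε with rfl | rfl
      · rw [one_mul]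
      · rw [neg_one_mul, ← Set.mem_neg, Set.neg_Icc, neg_neg]
    have huε : (fun x => u (ε * x)) = u := by
      ext x
      by_cases h : x ∈ I <;> simp [u, hIε, h]
    have hvε : MemLp (fun x => v (ε * x)) ∞ (volume : Measure ℝ) :=
      memLp_top_of_measurable_of_bound (hvm.comp (measurable_const_mul ε))
        (hvb.imp fun _ hC x => hC _)
    have hu := memLp_top_of_measurable_of_bound hum hub
    have hv := memLp_top_of_measurable_of_bound hvm hvb
    have hf : mulOp (fun x => v (ε * x)) (f : H1) = (ε : ℂ) • mulOp u (position f) := by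
      refine Lp.ext ?_
      filter_upwards [mulOp_apply hvε (f : H1), mulOp_apply hu (position f), position_apply f,
        Lp.coeFn_smul (ε : ℂ) (mulOp u (position f))] with x h₁ h₂ h₃ h₄
      rw [h₁, h₄, Pi.smul_apply, h₂, h₃]
      by_cases h : x ∈ I <;> simp [u, v, hIε, h, mul_assoc]
    have h₁ := DFunLike.congr_fun (hK v hvm hvb) (f : H1)
    have h₂ := DFunLike.congr_fun (hK u hum hub) (position f)
    rw [huε] at h₂
    simp only [ContinuousLinearMap.comp_apply] at h₁ h₂
    rw [hf, map_smul, ← h₂] at h₁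
    filter_upwards [mulOp_apply hv (K f), mulOp_apply hu (K (position f)),
      Lp.coeFn_smul (ε : ℂ) (mulOp u (K (position f))), Lp.coeFn_smul (ε : ℂ) (K (position f))]
      with x h₃ h₄ h₅ h₆ hx
    rw [h₁, h₅, Pi.smul_apply, h₄] at h₃
    rw [h₆, Pi.smul_apply]
    have hx' : x ∈ I := hx
    simpa [u, v, hx'] using h₃.symm
  have hall : ∀ᵐ x : ℝ, (x : ℂ) * (K f) x = ((ε : ℂ) • K (position f)) x := by
    filter_upwards [ae_all_iff.2 hae] with x hx
    obtain ⟨n, hn⟩ := exists_nat_ge |x|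
    exact hx n (abs_le.1 hn)
  have hmem : MemLp (fun x : ℝ => (x : ℂ) * (K f) x) 2 volume :=
    (Lp.memLp ((ε : ℂ) • K (position f))).ae_eq (Filter.EventuallyEq.symm hall)
  refine ⟨hmem, Lp.ext ?_⟩
  filter_upwards [hall, position_apply ⟨K f, hmem⟩] with x h₁ h₂
  rw [h₂, h₁]

/-- A bounded operator that both commutes and anticommutes with `x̂` vanishes. -/
theorem eq_zero_of_commutatorZero_of_anticommutatorZero {K : H1 →L[ℂ] H1}
    (hc : CommutatorZero position K) (ha : AnticommutatorZero position K) : K = 0 := by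
  have hdom (f : position.domain) : K f = 0 := by
    obtain ⟨h, h₁⟩ := hc f
    obtain ⟨_, h₂⟩ := ha f
    have h₃ : position ⟨K f, h⟩ = 0 := by
      have : (2 : ℂ) • position ⟨K f, h⟩ = 0 := by
        rw [two_smul, ← add_zero (_ + _)]
        nth_rewrite 1 [sub_eq_zero.1 h₁]
        rw [add_comm (K _), h₂, add_zero]
      exact (smul_eq_zero.1 this).resolve_left two_ne_zero
    have h₄ := position_apply ⟨K f, h⟩
    rw [h₃] at h₄
    refine Lp.ext ?_
    filter_upwards [h₄, Lp.coeFn_zero ℂ 2 (volume : Measure ℝ),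
      (Set.countable_singleton (0 : ℝ)).ae_notMem volume] with x h₅ h₆ h₇
    rw [h₆] at h₅ ⊢
    exact ((mul_eq_zero.1 h₅.symm).resolve_left (by simpa using h₇))
  ext1 g
  refine ext_inner_left ℂ fun f => ?_
  -- Truncations of `g` lie in the domain of `x̂` and converge weakly to `g`, so vanishing on the
  -- domain extends to `L²(ℝ)`.
  let I (n : ℕ) : Set ℝ := Set.Icc (-n : ℝ) n
  let u (n : ℕ) : ℝ → ℂ := (I n).indicator 1
  have hI (n : ℕ) : MeasurableSet (I n) := measurableSet_Icc
  have hum (n : ℕ) : Measurable (u n) := measurable_one.indicator (hI n)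
  have hub (n : ℕ) (x : ℝ) : ‖u n x‖ ≤ 1 := by by_cases h : x ∈ I n <;> simp [u, h]
  have hlim := tendsto_inner_mulOp (k := fun _ => 1) hum hub (fun x => ?_) (K.adjoint f) g
  · rw [mulOp_const, one_smul, ContinuousLinearMap.id_apply] at hlim
    simp_rw [ContinuousLinearMap.adjoint_inner_left] at hlim
    rw [zero_apply, inner_zero_right]
    refine tendsto_nhds_unique hlim (tendsto_const_nhds.congr fun n => ?_)
    have hu := memLp_top_of_measurable_of_bound (hum n) ⟨1, hub n⟩
    have hmem : mulOp (u n) g ∈ position.domain := by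
      refine MemLp.of_le ((Lp.memLp g).const_mul (n : ℂ)) ?_ ?_
      · exact Complex.measurable_ofReal.aestronglyMeasurable.mul (Lp.aestronglyMeasurable _)
      · filter_upwards [mulOp_apply hu g] with x hx
        rw [hx]
        by_cases h : x ∈ I n
        · have hx' : |x| ≤ n := abs_le.2 h
          simpa [u, h] using mul_le_mul_of_nonneg_right hx' (norm_nonneg (g x))
        · simp [u, h]
          positivity
    rw [hdom ⟨_, hmem⟩, inner_zero_right]
  · obtain ⟨N, hN⟩ := exists_nat_ge |x|
    refine tendsto_const_nhds.congr' ?_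
    filter_upwards [Filter.eventually_ge_atTop N] with n hn
    have : x ∈ I n := abs_le.1 (hN.trans (Nat.cast_le.2 hn))
    simp [u, this]

/-! ### Self-adjoint product operators -/

theorem exists_inner_apply_ne_zero {A : H1 →L[ℂ] H1} (hA : A ≠ 0) :
    ∃ f g, inner ℂ f (A g) ≠ 0 := by
  by_contra! h
  refine hA ?_
  ext1 g
  exact ext_inner_left ℂ fun f => by rw [h, zero_apply, inner_zero_right]

namespace IsTensorProduct

variable {OB OC : H1 →L[ℂ] H1} {O : H2 →L[ℂ] H2}

theorem left_ne_zero (hO : IsTensorProduct O OB OC) (hne : O ≠ 0) : OB ≠ 0 := by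
  rintro rfl
  exact hne (clm_eq_of_forall_tensor fun f g => by
    rw [hO, zero_apply, zero_apply, tensor_zero_left])

theorem right_ne_zero (hO : IsTensorProduct O OB OC) (hne : O ≠ 0) : OC ≠ 0 := by
  rintro rfl
  exact hne (clm_eq_of_forall_tensor fun f g => by
    rw [hO, zero_apply, zero_apply, tensor_zero_right])

/-- The factors of a non-zero self-adjoint product operator are self-adjoint up to inverse
scalars. -/
theorem exists_smul_adjoint (hO : IsTensorProduct O OB OC) (hne : O ≠ 0)
    (hherm : IsSelfAdjoint O) : ∃ c : ℂ, OB = c • OB.adjoint ∧ OC.adjoint = c • OC := by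
  -- Matrix elements of `OB ⊗ OC = OB† ⊗ OC†`; fixing a non-zero one of `OC` determines the scalar.
  have key (f f' g g' : H1) : inner ℂ f (OB f') * inner ℂ g (OC g') =
      inner ℂ f (OB.adjoint f') * inner ℂ g (OC.adjoint g') := by
    rw [← inner_tensor_tensor, ← hO, ContinuousLinearMap.adjoint_inner_right,
      ContinuousLinearMap.adjoint_inner_right, ← inner_tensor_tensor, ← hO]
    exact (hherm.isSymmetric (tensor f g) (tensor f' g')).symm
  obtain ⟨g, g', hg⟩ := exists_inner_apply_ne_zero (hO.right_ne_zero hne)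
  have hB : OB = (inner ℂ g (OC.adjoint g') / inner ℂ g (OC g')) • OB.adjoint := by
    ext1 f'
    refine ext_inner_left ℂ fun f => ?_
    rw [smul_apply, inner_smul_right, div_mul_eq_mul_div, eq_div_iff hg, key, mul_comm]
  refine ⟨_, hB, ?_⟩
  set c := inner ℂ g (OC.adjoint g') / inner ℂ g (OC g')
  have hB' : OB.adjoint ≠ 0 := fun h =>
    hO.left_ne_zero hne (ContinuousLinearMap.adjoint.injective (h.trans (map_zero _).symm))
  obtain ⟨f, f', hf⟩ := exists_inner_apply_ne_zero hB'
  ext1 u'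
  refine ext_inner_left ℂ fun u => mul_left_cancel₀ hf ?_
  rw [← key, smul_apply, inner_smul_right]
  nth_rewrite 1 [hB]
  rw [smul_apply, inner_smul_right]
  ring

/-- The slices of the commutation relation with `exp (i x̂_C p̂_B)`. -/
theorem mulOp_correlation_comp (hO : IsTensorProduct O OB OC) (hne : O ≠ 0)
    (hherm : IsSelfAdjoint O) (hinv : Invariant 0 O) (f g : H1) :
    mulOp (correlation f (OB g)) ∘L OC = OC ∘L mulOp (correlation (OB.adjoint f) g) := by
  obtain ⟨c, hB, hC⟩ := hO.exists_smul_adjoint hne hherm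
  rw [invariant_iff_commute] at hinv
  have hadj (u : H1) : O (tensor f u) = tensor (OB.adjoint f) (OC.adjoint u) := by
    rw [hO, hC, smul_apply, tensor_smul_right, ← tensor_smul_left, ← smul_apply, ← hB]
  ext1 v
  refine ext_inner_left ℂ fun u => ?_
  calc inner ℂ u (mulOp (correlation f (OB g)) (OC v))
      = inner ℂ (tensor f u) (expXP 0 (O (tensor g v))) := by
        rw [hO, inner_tensor_expXP_tensor]
    _ = inner ℂ (tensor f u) (O (expXP 0 (tensor g v))) :=
        congrArg _ (DFunLike.congr_fun hinv.eq (tensor g v))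
    _ = inner ℂ (O (tensor f u)) (expXP 0 (tensor g v)) :=
        (hherm.isSymmetric (tensor f u) (expXP 0 (tensor g v))).symm
    _ = inner ℂ u (OC (mulOp (correlation (OB.adjoint f) g) v)) := by
        rw [hadj, inner_tensor_expXP_tensor, ContinuousLinearMap.adjoint_inner_left]

/-- A non-zero self-adjoint product operator that is invariant in the sector `0` commutes
(`ε = 1`) or anticommutes (`ε = -1`) with `p̂_B` and `x̂_C`, in exponentiated form. -/
theorem exists_sign (hO : IsTensorProduct O OB OC) (hne : O ≠ 0)
    (hherm : IsSelfAdjoint O) (hinv : Invariant 0 O) :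
    ∃ ε : ℝ, (ε = 1 ∨ ε = -1) ∧ (∀ a, TranslationRel OB a (ε * a)) ∧
      ∀ h : ℝ → ℂ, Measurable h → (∃ C, ∀ x, ‖h x‖ ≤ C) →
        mulOp h ∘L OC = OC ∘L mulOp fun x => h (ε * x) := by
  have hrel := hO.mulOp_correlation_comp hne hherm hinv
  obtain ⟨c, hB, -⟩ := hO.exists_smul_adjoint hne hherm
  rcases forall_translationRel_or_countable hB with ⟨ε, hε, h⟩ | h
  · exact ⟨ε, hε, h, fun k hk ⟨_, hC⟩ => mulOp_comp_eq (hO.left_ne_zero hne) hrel hε h hk hC⟩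
  · exact absurd (eq_zero_of_countable (hO.left_ne_zero hne) hrel h) (hO.right_ne_zero hne)

theorem commute_phaseOp (hO : IsTensorProduct O OB OC) {P : ℝ}
    (hC : mulOp (phase P) ∘L OC = OC ∘L mulOp (phase P)) : Commute (phaseOp P) O := by
  refine clm_eq_of_forall_tensor fun f g => ?_
  change phaseOp P (O (tensor f g)) = O (phaseOp P (tensor f g))
  rw [hO, phaseOp_tensor, phaseOp_tensor, hO]
  exact congrArg _ (DFunLike.congr_fun hC g)

theorem mulOp_phase_comp_of_commute (hO : IsTensorProduct O OB OC) (hB : OB ≠ 0) {P : ℝ}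
    (h : Commute (phaseOp P) O) : mulOp (phase P) ∘L OC = OC ∘L mulOp (phase P) := by
  obtain ⟨f, hf⟩ : ∃ f, OB f ≠ 0 := by
    by_contra! h₀
    exact hB (ContinuousLinearMap.ext h₀)
  ext1 g
  have h₁ : phaseOp P (O (tensor f g)) = O (phaseOp P (tensor f g)) :=
    DFunLike.congr_fun h.eq (tensor f g)
  rw [hO, phaseOp_tensor, phaseOp_tensor, hO] at h₁
  exact tensor_right_cancel hf h₁

end IsTensorProduct

/-! ### Phases under reflection, and the two signs -/

/-- Equality means `exp (2 i x P) = 1`, i.e. `x ∈ (π / P) ℤ`. -/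
theorem countable_setOf_phase_eq {P : ℝ} (hP : P ≠ 0) :
    {x : ℝ | phase P x = phase P (-x)}.Countable := by
  refine (Set.countable_range fun n : ℤ => -(n * Real.pi / P)).mono ?_
  intro x hx
  obtain ⟨n, hn⟩ := Complex.exp_eq_exp_iff_exists_int.1 hx
  refine ⟨n, ?_⟩
  have h₁ := congrArg Complex.im hn
  simp at h₁
  field_simp
  linarith

/-- An operator that reflects the line commutes with no non-trivial phase. -/
theorem eq_zero_of_commute_phase {K : H1 →L[ℂ] H1}
    (hK : ∀ h : ℝ → ℂ, Measurable h → (∃ C, ∀ x, ‖h x‖ ≤ C) →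
      mulOp h ∘L K = K ∘L mulOp fun x => h (-1 * x)) {P : ℝ} (hP : P ≠ 0)
    (hcomm : mulOp (phase P) ∘L K = K ∘L mulOp (phase P)) : K = 0 := by
  have hm : Measurable fun x => phase P (-x) := (measurable_phase P).comp measurable_neg
  have hb : ∃ C, ∀ x, ‖phase P (-x)‖ ≤ C := ⟨1, fun x => (norm_phase P _).le⟩
  -- Applied to the reflected phase, with `hcomm`, this shows that the phase and its reflection
  -- multiply `K g` alike; they differ almost everywhere.
  have h := hK _ hm hb
  simp only [neg_one_mul, neg_neg] at h
  change _ = K ∘L mulOp (phase P) at h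
  rw [← hcomm] at h
  ext1 g
  have hg := DFunLike.congr_fun h g
  simp only [ContinuousLinearMap.comp_apply] at hg
  refine Lp.ext ?_
  filter_upwards [mulOp_apply (memLp_top_phase P) (K g),
    mulOp_apply (memLp_top_of_measurable_of_bound hm hb) (K g),
    (countable_setOf_phase_eq hP).ae_notMem volume,
    Lp.coeFn_zero ℂ 2 (volume : Measure ℝ)] with x h₁ h₂ h₃ h₄
  rw [zero_apply, h₄]
  rw [hg, h₁] at h₂
  by_contra h₅
  exact h₃ (mul_right_cancel₀ h₅ h₂)

theorem commutatorZero_of_apply {T : H1 →ₗ.[ℂ] H1} {A : H1 →L[ℂ] H1}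
    (h : ∀ f : T.domain, ∃ h : A f ∈ T.domain, T ⟨A f, h⟩ = ((1 : ℝ) : ℂ) • A (T f)) :
    CommutatorZero T A := by
  intro f
  obtain ⟨hf, h₁⟩ := h f
  exact ⟨hf, by rw [h₁, Complex.ofReal_one, one_smul, sub_self]⟩

theorem anticommutatorZero_of_apply {T : H1 →ₗ.[ℂ] H1} {A : H1 →L[ℂ] H1}
    (h : ∀ f : T.domain, ∃ h : A f ∈ T.domain, T ⟨A f, h⟩ = ((-1 : ℝ) : ℂ) • A (T f)) :
    AnticommutatorZero T A := by
  intro f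
  obtain ⟨hf, h₁⟩ := h f
  exact ⟨hf, by rw [h₁, Complex.ofReal_neg, Complex.ofReal_one, neg_smul, one_smul, neg_add_cancel]⟩

end QRF

end

/-! ### The theorem, by cases on the sign -/

theorem proposition1 (OB OC : QRF.H1 →L[ℂ] QRF.H1) (O : QRF.H2 →L[ℂ] QRF.H2)
    (hprod : QRF.IsTensorProduct O OB OC) (hne : O ≠ 0) (hherm : IsSelfAdjoint O)
    (hinv : QRF.Invariant 0 O) :
    (∀ P : ℝ, P ≠ 0 →
      (¬ QRF.Invariant P O ↔
        QRF.AnticommutatorZero QRF.momentum OB ∧ QRF.AnticommutatorZero QRF.position OC)) ∧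
    Xor (QRF.CommutatorZero QRF.momentum OB ∧ QRF.CommutatorZero QRF.position OC)
      (QRF.AnticommutatorZero QRF.momentum OB ∧ QRF.AnticommutatorZero QRF.position OC) ∧
    (QRF.CommutatorZero QRF.momentum OB ∧ QRF.CommutatorZero QRF.position OC →
      ∀ P : ℝ, QRF.Invariant P O) := by
  have hexcl (hc : QRF.CommutatorZero QRF.position OC)
      (ha : QRF.AnticommutatorZero QRF.position OC) : False :=
    hprod.right_ne_zero hne (QRF.eq_zero_of_commutatorZero_of_anticommutatorZero hc ha)
  obtain ⟨ε, hε, hB, hC⟩ := hprod.exists_sign hne hherm hinv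
  have hp := QRF.momentum_apply_of_translationRel hB
  have hx := QRF.position_apply_of_mulOp_comp hε hC
  rcases hε with rfl | rfl
  · have hcB := QRF.commutatorZero_of_apply hp
    have hcC := QRF.commutatorZero_of_apply hx
    have hall (P : ℝ) : QRF.Invariant P O := by
      refine (QRF.invariant_iff_commute_phaseOp hinv P).2 (hprod.commute_phaseOp ?_)
      simpa only [one_mul] using hC _ (QRF.measurable_phase P)
        ⟨1, fun z => (QRF.norm_phase P z).le⟩
    exact ⟨fun P _ => ⟨fun h => absurd (hall P) h, fun h => (hexcl hcC h.2).elim⟩,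
      Or.inl ⟨⟨hcB, hcC⟩, fun h => hexcl hcC h.2⟩, fun _ => hall⟩
  · have haB := QRF.anticommutatorZero_of_apply hp
    have haC := QRF.anticommutatorZero_of_apply hx
    refine ⟨fun P hP => ⟨fun _ => ⟨haB, haC⟩, fun _ h => hprod.right_ne_zero hne ?_⟩,
      Or.inr ⟨⟨haB, haC⟩, fun h => hexcl h.2 haC⟩, fun h => (hexcl h.2 haC).elim⟩
    exact QRF.eq_zero_of_commute_phase hC hP (hprod.mulOp_phase_comp_of_commute
      (hprod.left_ne_zero hne) ((QRF.invariant_iff_commute_phaseOp hinv P).1 h))
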